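/- Consider a satellite with $N$ antennas serving $K$ single-antenna users, the first $K$ members of a fixed sequence of users. The channel vectors $\mathbf h_i\in\mathbb C^N$ are independent, and $\mathbf h_i$ has i.i.d. Shadowed-Rician entries ${\rm SR}(m_i,\Omega_i,b_i)$, i.e. each entry is $Z+X+\jmath Y$ with $Z\sim{\rm Nakagami}(m_i,\Omega_i)$, $X,Y\sim\mathcal N(0,b_i)$ independent. The satellite knows $\hat{\mathbf h}_i=\mathbf h_i+\tilde{\mathbf h}_i$, where the errors $\tilde{\mathbf h}_i\sim\mathcal{CN}(\mathbf 0_N,\sigma_{e_i}^2\mathbf I_N)$ are mutually independent and independent of the channels. It sends $\sqrt{\alpha\rho}\,\mathbf w_cx_c+\sum_{i=1}^K\sqrt{\alpha\bar\rho}\,\mathbf w_ix_i$ with uncorrelated zero-mean unit-power symbols, $\mathbf w_c=\sum_{i=1}^K\hat{\mathbf h}_i^*$, $\mathbf w_i=\hat{\mathbf h}_i^*$, $\rho\in[0,1]$, $\bar\rho=1-\rho$ and $\alpha=P_t/\mathbb E\{\rho\|\mathbf w_c\|^2+\bar\rho\sum_{i=1}^K\|\mathbf w_i\|^2\}$, $P_t>0$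 (so $\alpha$ depends on $N$ and $K$); user $k$ receives this through $\mathbf h_k^T$ with noise of variance $\sigma_k^2>0$. The parameters $m_i,\Omega_i,b_i,\sigma_{e_i}^2,\sigma_i^2,P_t,\rho$ do not depend on $N,K$; $\Omega_i>0$, $b_i\ge0$, and the fading parameters are uniformly bounded: $\inf_i m_i>0$, $\sup_i\Omega_i<\infty$, $\sup_i b_i<\infty$. After the common message $x_c$ has been removed perfectly, the SINR of user $k\le K$ for its own private message $x_k$, with signal and interference powers averaged over the symbols, the noise and the estimation errors for given channels, is $$\gamma_k^{(p)}=\frac{\alpha\bar\rho\|\mathbf h_k\|^4+\alpha\bar\rho\|\mathbf h_k\|^2\sigma_{e_k}^2}{\sigma_k^2+\alpha\bar\rho\sum_{i\ne k}\big(|\mathbf h_k^T\mathbf h_i^*|^2+\|\mathbf h_k\|^2\sigma_{e_i}^2\big)} .$$ The rate $\log_2(1+\gamma_k^{(p)})$ is integrable; let $\bar R_k^{(p)}=\mathbb E\{\log_2(1+\gamma_k^{(p)})\}$ be the ergodic rate, and let $$\tilde R_k^{(p)}=\log_2\Bigg(1+\frac{\alpha\bar\rho D_k+\alpha\bar\rho\sigma_{e_k}^2NA_k}{\sigma_k^2+\alpha\bar\rho\sum_{i\ne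 k}\big(E_{k,i}+\sigma_{e_i}^2NA_k\big)}\Bigg),$$ where, with $C_k=\frac{\Gamma(m_k+1/2)}{\Gamma(m_k)}\sqrt{\Omega_k/m_k}$ and $i\ne k$, $$A_k=\mathbb E\{|\mathbf h_k(\vartheta)|^2\}=2b_k+\Omega_k,\qquad D_k=\mathbb E\{\|\mathbf h_k\|^4\}=N\Big(4b_k^2+4b_k\Omega_k+\frac{\Omega_k^2}{m_k}\Big)+N^2A_k^2,$$ $$E_{k,i}=\mathbb E\{|\mathbf h_k^T\mathbf h_i^*|^2\}=NA_kA_i+N(N-1)C_k^2C_i^2 .$$ Then for every fixed user $k$ the approximation converges to the ergodic rate: $\bar R_k^{(p)}-\tilde R_k^{(p)}\to0$ as $N\to\infty$ and $K\to\infty$ jointly, with no restriction on how $N$ and $K$ grow relative to each other. -/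

import Mathlib

open MeasureTheory ProbabilityTheory Matrix
open scoped NNReal ENNReal

noncomputable section

/-- Nakagami distribution with shape `m` and spread `Ω`: density
`2 m^m / (Γ(m) Ω^m) x^(2m-1) exp(-m x² / Ω)` on `x > 0`. -/
def nakagami (m Ω : ℝ) : Measure ℝ :=
  volume.withDensity fun x => ENNReal.ofReal
    (if 0 < x then
      2 * m ^ m / (Real.Gamma m * Ω ^ m) * x ^ (2 * m - 1) * Real.exp (-(m * x ^ 2 / Ω))
    else 0)

/-- Circularly symmetric complex normal distribution `CN(0, v)`: independent real and imaginary
parts, each `N(0, v/2)`. -/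
def complexNormal (v : ℝ≥0) : Measure ℂ :=
  ((gaussianReal 0 (v / 2)).prod (gaussianReal 0 (v / 2))).map
    fun p => (p.1 : ℂ) + (p.2 : ℂ) * Complex.I

/-- Shadowed-Rician distribution `SR(m, Ω, b)`: the law of `h⁽ˡ⁾ + h⁽ˢ⁾` with independent
`h⁽ˡ⁾ ∼ Nakagami(m, Ω)` and `h⁽ˢ⁾ ∼ CN(0, 2b)`. -/
def shadowedRician (m Ω : ℝ) (b : ℝ≥0) : Measure ℂ :=
  ((nakagami m Ω).prod (complexNormal (2 * b))).map fun p => (p.1 : ℂ) + p.2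

/-- `‖v‖²` for the Euclidean norm of `v ∈ ℂᴺ`. -/
def sqNorm {N : ℕ} (v : Fin N → ℂ) : ℝ := ∑ t, ‖v t‖ ^ 2

/-- Parameters of the land mobile satellite system. The users form a sequence, and the system with
`K` users serves the users `0, …, K - 1`. -/
structure LMSSystem where
  /-- Nakagami shape of each user -/
  m : ℕ → ℝ
  /-- Nakagami spread of each user -/
  Ω : ℕ → ℝ
  /-- half the scatter power of each user -/
  b : ℕ → ℝ≥0
  /-- variance `σ_e²` of the channel estimation error of each user -/
  errVar : ℕ → ℝ≥0
  /-- receiver noise variance `σ²` of each user -/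
  noiseVar : ℕ → ℝ
  /-- average transmit power `P_t` -/
  power : ℝ
  /-- power splitting factor `ρ` between common and private messages -/
  ρ : ℝ

namespace LMSSystem

variable (S : LMSSystem)

/-- Law of the true channels `(h_k)_k`: independent entries, `h_k(t) ∼ SR(m_k, Ω_k, b_k)`. -/
def channelLaw (N K : ℕ) : Measure (Fin K → Fin N → ℂ) :=
  Measure.pi fun k => Measure.pi fun _ => shadowedRician (S.m k) (S.Ω k) (S.b k)

/-- Law of the estimation errors: independent entries, the error of user `k` being
`CN(0, σ_{e_k}² I)`. -/
def errorLaw (N K : ℕ) : Measure (Fin K → Fin N → ℂ) :=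
  Measure.pi fun k => Measure.pi fun _ => complexNormal (S.errVar k)

/-- The precoding matrix `W = [w_c, w_1, …, w_K]` built from the channel estimates `ĥ`: the
column `none` is the maximum ratio precoder `w_c = ∑ i, ĥ_i^*` of the common message, and the
column `some i` is the matched filter `w_i = ĥ_i^*` of the `i`-th private message. -/
def precoder {N K : ℕ} (hHat : Fin K → Fin N → ℂ) : Matrix (Fin N) (Option (Fin K)) ℂ :=
  Matrix.of fun t c => match c with
    | none => ∑ i, star (hHat i t)
    | some i => star (hHat i t)

/-- The power splitting matrix `P = Diag(√ρ, √(1-ρ), …, √(1-ρ))`. -/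
def splitting (K : ℕ) : Matrix (Option (Fin K)) (Option (Fin K)) ℂ :=
  Matrix.diagonal fun c => match c with
    | none => (Real.sqrt S.ρ : ℂ)
    | some _ => (Real.sqrt (1 - S.ρ) : ℂ)

/-- The power normalization factor `α = P_t / E{Tr{Wᴴ W P²}}`; the expectation is over the
channels and the independent estimation errors. -/
def alpha (N K : ℕ) : ℝ :=
  S.power / ∫ p : (Fin K → Fin N → ℂ) × (Fin K → Fin N → ℂ),
    (Matrix.trace ((precoder (p.1 + p.2))ᴴ * precoder (p.1 + p.2) * S.splitting K ^ 2)).re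
      ∂((S.channelLaw N K).prod (S.errorLaw N K))

/-- Received power `|√(α (1-ρ)) h_kᵀ w_i|²` at user `k` of the `i`-th (unit-power) private symbol
when the channels are `h`, averaged over the estimation errors. -/
def privatePower (N K : ℕ) (h : Fin K → Fin N → ℂ) (k i : Fin K) : ℝ :=
  ∫ e, ‖(Real.sqrt (S.alpha N K * (1 - S.ρ)) : ℂ) *
      (h k ⬝ᵥ fun t => precoder (h + e) t (some i))‖ ^ 2 ∂(S.errorLaw N K)

/-- SINR at user `k` for decoding its own private message, the common message being removed. -/
def sinr (N K : ℕ) (k : Fin K) (h : Fin K → Fin N → ℂ) : ℝ :=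
  S.privatePower N K h k k /
    (S.noiseVar k + ∑ i ∈ Finset.univ.erase k, S.privatePower N K h k i)

/-- The instantaneous rate of user `k` for its own private message. -/
def privateRate (N K : ℕ) (k : Fin K) (h : Fin K → Fin N → ℂ) : ℝ :=
  Real.logb 2 (1 + S.sinr N K k h)

/-- The ergodic rate of user `k` for its own private message. -/
def ergodicPrivateRate (N K : ℕ) (k : Fin K) : ℝ :=
  ∫ h, S.privateRate N K k h ∂(S.channelLaw N K)

/-- `A_k = E{|h_k(t)|²}`. -/
def momentA (k : ℕ) : ℝ := ∫ z, ‖z‖ ^ 2 ∂(shadowedRician (S.m k) (S.Ω k) (S.b k))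

/-- `D_k = E{‖h_k‖⁴}`. -/
def momentD (N K : ℕ) (k : Fin K) : ℝ := ∫ h, sqNorm (h k) ^ 2 ∂(S.channelLaw N K)

/-- `E_{k,i} = E{|h_kᵀ h_i^*|²}`. -/
def momentE (N K : ℕ) (k i : Fin K) : ℝ := ∫ h, ‖h k ⬝ᵥ star (h i)‖ ^ 2 ∂(S.channelLaw N K)

/-- The mean `C_k = Γ(m_k + 1/2) / Γ(m_k) √(Ω_k / m_k)` of a channel entry. -/
def meanC (k : ℕ) : ℝ :=
  Real.Gamma (S.m k + 1 / 2) / Real.Gamma (S.m k) * Real.sqrt (S.Ω k / S.m k)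

/-- The approximation of the ergodic rate of user `k` for its own private message. -/
def approxPrivateRate (N K : ℕ) (k : Fin K) : ℝ :=
  Real.logb 2 (1 +
    (S.alpha N K * (1 - S.ρ) * S.momentD N K k
        + S.alpha N K * (1 - S.ρ) * S.errVar k * N * S.momentA k) /
      (S.noiseVar k + S.alpha N K * (1 - S.ρ) *
        ∑ i ∈ Finset.univ.erase k, (S.momentE N K k i + S.errVar i * N * S.momentA k)))

end LMSSystem

end

/-! Write `T` for the disturbance (noise plus interference) and `U` for the signal power of user
`k`. The instantaneous rate is `(log (T + U) - log T) / log 2`, and the approximation is the same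
expression with the expectation moved inside each logarithm
(`ergodicPrivateRate_sub_approxPrivateRate`). The error is therefore a difference of two Jensen gaps
of the logarithm. For a variable bounded below by `σ > 0` with mean `a` and relative variance at
most `δ`, the gap is at most `(2 + 4 log (a / σ)) δ` (`HasRelVarLE.abs_integral_log_sub_log_le`). It
remains to show that the relative variances are `O(1/N)` and the means `O(N)`, both uniformly in
`K`; the error is then `O(log N / N)`, and no relation between `N` and `K` is needed.

The means are controlled by the power normalization: `α (1 - ρ) N ∑ (A_i + σ_{e_i}²) ≤ P_t`
(`alpha_mul_le`) cancels the growth of the interference with `K`.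

The relative variance of the interference is the main point. Given the channel of user `k`, the
interfering powers are independent, with conditional mean `s |∑ h_k(t)|² + v ‖h_k‖²`, where `s = ∑
C_i²` and `v = ∑ (A_i - C_i²)`. This conditional mean depends on one user only and concentrates at
rate `1/N` (`exists_hasRelVarLE`). The deviation from it has second moment at most a multiple of `N²
(N s + a)`, with `a = ∑ A_i` (`integral_interference_sub_sq_le`), while the mean interference
dominates both `N a` and `N² s` up to constants. Since `s` contains at least one fixed positive
term, the ratio to the squared mean is `O(1/N)` whatever `K` is (`interference_scalar_bound`). The
uniform bounds on the fading parameters serve to bound the conditional variances of all users by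
common constants. -/

/-! ### Random variables with moments of all orders. -/

section FiniteMoments

variable {α β E F 𝕜 : Type*} {mα : MeasurableSpace α} {mβ : MeasurableSpace β} {μ : Measure α}
  {ν : Measure β} [NormedAddCommGroup E] [NormedAddCommGroup F]

/-- `f` has finite absolute moments of all orders. -/
def FiniteMoments (f : α → E) (μ : Measure α) : Prop := ∀ p : ℕ, MemLp f p μ

namespace FiniteMoments

lemma memLp_two {f : α → E} (hf : FiniteMoments f μ) : MemLp f 2 μ := by
  simpa using hf 2

lemma integrable {f : α → E} (hf : FiniteMoments f μ) : Integrable f μ :=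
  memLp_one_iff_integrable.1 (by simpa using hf 1)

lemma aestronglyMeasurable {f : α → E} (hf : FiniteMoments f μ) : AEStronglyMeasurable f μ :=
  hf.integrable.aestronglyMeasurable

lemma const [IsFiniteMeasure μ] (c : E) : FiniteMoments (fun _ : α => c) μ :=
  fun _ => memLp_const c

lemma add {f g : α → E} (hf : FiniteMoments f μ) (hg : FiniteMoments g μ) :
    FiniteMoments (fun x => f x + g x) μ := fun p => (hf p).add (hg p)

lemma sub {f g : α → E} (hf : FiniteMoments f μ) (hg : FiniteMoments g μ) :
    FiniteMoments (fun x => f x - g x) μ := fun p => (hf p).sub (hg p)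

lemma sum {ι : Type*} {s : Finset ι} {f : ι → α → E} (hf : ∀ i ∈ s, FiniteMoments (f i) μ) :
    FiniteMoments (fun x => ∑ i ∈ s, f i x) μ := fun p => by
  simpa using memLp_finsetSum s (fun i hi => hf i hi p)

lemma norm {f : α → E} (hf : FiniteMoments f μ) : FiniteMoments (fun x => ‖f x‖) μ :=
  fun p => (hf p).norm

lemma mono {f : α → E} {g : α → F} (hf : FiniteMoments f μ) (hg : AEStronglyMeasurable g μ)
    (h : ∀ x, ‖g x‖ ≤ ‖f x‖) : FiniteMoments g μ :=
  fun p => (hf p).mono hg (.of_forall h)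

/-- Hölder with exponents `2p, 2p, p`. Stability under products is what makes every polynomial in
the channel entries integrable without tracking exponents. -/
lemma mul [IsFiniteMeasure μ] [NormedRing 𝕜] {f g : α → 𝕜}
    (hf : FiniteMoments f μ) (hg : FiniteMoments g μ) :
    FiniteMoments (fun x => f x * g x) μ := by
  intro p
  rcases Nat.eq_zero_or_pos p with rfl | hp
  · have := (hf 0).aestronglyMeasurable.mul (hg 0).aestronglyMeasurable
    simpa [memLp_zero_iff_aestronglyMeasurable, Pi.mul_def] using this
  have : ENNReal.HolderTriple ((2 * p : ℕ) : ℝ≥0∞) ((2 * p : ℕ) : ℝ≥0∞) p := by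
    constructor
    have h0 : (p : ℝ≥0∞) ≠ 0 := by simpa using hp.ne'
    push_cast
    rw [ENNReal.mul_inv (by simp) (by simp), ← add_mul, ENNReal.inv_two_add_inv_two, one_mul]
  exact (hg (2 * p)).mul (hf (2 * p))

lemma const_mul [IsFiniteMeasure μ] [NormedRing 𝕜] {f : α → 𝕜} (c : 𝕜)
    (hf : FiniteMoments f μ) : FiniteMoments (fun x => c * f x) μ := (const c).mul hf

lemma pow [IsFiniteMeasure μ] [NormedRing 𝕜] {f : α → 𝕜}
    (hf : FiniteMoments f μ) (n : ℕ) : FiniteMoments (fun x => f x ^ n) μ := by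
  induction n with
  | zero => simpa using const (1 : 𝕜)
  | succ n ih => simpa [pow_succ] using ih.mul hf

lemma ofReal {f : α → ℝ} (hf : FiniteMoments f μ) : FiniteMoments (fun x => (f x : ℂ)) μ :=
  fun p => (hf p).ofReal

lemma conj {f : α → ℂ} (hf : FiniteMoments f μ) : FiniteMoments (fun x => star (f x)) μ :=
  hf.mono (continuous_star.comp_aestronglyMeasurable hf.aestronglyMeasurable)
    (fun x => by simp)

lemma comp {f : β → E} (hf : FiniteMoments f ν) {g : α → β} (hg : MeasurePreserving g μ ν) :
    FiniteMoments (fun x => f (g x)) μ := fun p => (hf p).comp_measurePreserving hg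

lemma comp_fst {f : α → E} (hf : FiniteMoments f μ) (ν : Measure β) [IsFiniteMeasure ν] :
    FiniteMoments (fun x : α × β => f x.1) (μ.prod ν) := fun p => (hf p).comp_fst ν

lemma comp_snd [SFinite ν] {f : β → E} (hf : FiniteMoments f ν) (μ : Measure α)
    [IsFiniteMeasure μ] : FiniteMoments (fun x : α × β => f x.2) (μ.prod ν) :=
  fun p => (hf p).comp_snd μ

lemma comp_eval {ι : Type*} [Fintype ι] {X : ι → Type*} {mX : ∀ i, MeasurableSpace (X i)}
    {μ : ∀ i, Measure (X i)} [∀ i, IsProbabilityMeasure (μ i)] {i : ι} {f : X i → E}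
    (hf : FiniteMoments f (μ i)) : FiniteMoments (fun x => f (x i)) (Measure.pi μ) :=
  hf.comp (measurePreserving_eval μ i)

lemma of_integrable_pow [IsFiniteMeasure μ] {f : α → ℝ} (hm : AEStronglyMeasurable f μ)
    (hf : ∀ n : ℕ, Integrable (fun x => ‖f x‖ ^ n) μ) : FiniteMoments f μ := by
  intro p
  rcases Nat.eq_zero_or_pos p with rfl | hp
  · simpa [memLp_zero_iff_aestronglyMeasurable] using hm
  rw [← integrable_norm_rpow_iff hm (by simpa using hp.ne') (by simp)]
  simpa using hf p

end FiniteMoments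

lemma finiteMoments_map {f : β → E} {g : α → β} (hg : AEMeasurable g μ)
    (hf : AEStronglyMeasurable f (μ.map g)) (h : FiniteMoments (fun x => f (g x)) μ) :
    FiniteMoments f (μ.map g) := fun p => (memLp_map_measure_iff hf hg).2 (h p)

end FiniteMoments

/-! ### Moments of the Nakagami distribution. -/

section Nakagami

lemma nakagami_density_measurable (m Ω : ℝ) : Measurable fun x : ℝ => ENNReal.ofReal
    (if 0 < x then
      2 * m ^ m / (Real.Gamma m * Ω ^ m) * x ^ (2 * m - 1) * Real.exp (-(m * x ^ 2 / Ω))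
    else 0) := by
  refine (Measurable.ite measurableSet_Ioi ?_ measurable_const).ennreal_ofReal
  fun_prop

lemma nakagami_density_nonneg {m Ω : ℝ} (hm : 0 < m) (hΩ : 0 < Ω) (x : ℝ) :
    0 ≤ (if 0 < x then
      2 * m ^ m / (Real.Gamma m * Ω ^ m) * x ^ (2 * m - 1) * Real.exp (-(m * x ^ 2 / Ω))
    else 0) := by
  have := Real.Gamma_pos_of_pos hm
  split_ifs with h
  · positivity
  · rfl

/-- Brings the integrand to the form `x ^ s * exp (-b x ^ 2)` on the half-line, whose integral is a
Gamma value. -/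
lemma nakagami_smul_pow (m Ω : ℝ) (n : ℕ) :
    (fun x : ℝ => (if 0 < x then
      2 * m ^ m / (Real.Gamma m * Ω ^ m) * x ^ (2 * m - 1) * Real.exp (-(m * x ^ 2 / Ω))
    else 0) * x ^ n) = Set.indicator (Set.Ioi 0) fun x =>
      2 * m ^ m / (Real.Gamma m * Ω ^ m) *
        (x ^ (2 * m - 1 + n) * Real.exp (-(m / Ω) * x ^ (2 : ℝ))) := by
  ext x
  by_cases hx : 0 < x
  · rw [Set.indicator_of_mem (Set.mem_Ioi.2 hx), if_pos hx, Real.rpow_add hx, Real.rpow_natCast,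
      Real.rpow_two]
    have : -(m * x ^ 2 / Ω) = -(m / Ω) * x ^ 2 := by ring
    rw [this]
    ring
  · rw [Set.indicator_of_notMem (by simpa using hx), if_neg hx, zero_mul]

lemma nakagami_integrable_pow {m Ω : ℝ} (hm : 0 < m) (hΩ : 0 < Ω) (n : ℕ) :
    Integrable (fun x => x ^ n) (nakagami m Ω) := by
  rw [nakagami, integrable_withDensity_iff_integrable_smul' (nakagami_density_measurable m Ω)
    (by simp)]
  simp only [ENNReal.toReal_ofReal (nakagami_density_nonneg hm hΩ _), smul_eq_mul]
  rw [nakagami_smul_pow, integrable_indicator_iff measurableSet_Ioi]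
  exact (integrableOn_rpow_mul_exp_neg_mul_rpow (by have : (0 : ℝ) ≤ n := n.cast_nonneg
                                                    linarith) two_pos (by positivity)).const_mul _

lemma nakagami_moment {m Ω : ℝ} (hm : 0 < m) (hΩ : 0 < Ω) (n : ℕ) :
    ∫ x, x ^ n ∂(nakagami m Ω) =
      Real.Gamma (m + n / 2) / Real.Gamma m * Real.sqrt (Ω / m) ^ n := by
  have hn : (0 : ℝ) ≤ n := n.cast_nonneg
  have hG := Real.Gamma_pos_of_pos hm
  rw [nakagami, integral_withDensity_eq_integral_toReal_smul (nakagami_density_measurable m Ω)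
    (by simp)]
  simp only [ENNReal.toReal_ofReal (nakagami_density_nonneg hm hΩ _), smul_eq_mul]
  rw [nakagami_smul_pow, integral_indicator measurableSet_Ioi, integral_const_mul,
    integral_rpow_mul_exp_neg_mul_rpow two_pos (by linarith) (by positivity)]
  have h1 : (2 * m - 1 + n + 1) / 2 = m + n / 2 := by ring
  have h2 : -(2 * m - 1 + n + 1) / 2 = -m + -(n / 2) := by ring
  have h3 : Real.sqrt (Ω / m) ^ n = (m / Ω) ^ (-(n / 2 : ℝ)) := by
    rw [Real.sqrt_eq_rpow, ← Real.rpow_natCast, ← Real.rpow_mul (by positivity),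
      Real.rpow_neg (by positivity), ← Real.inv_rpow (by positivity), inv_div]
    congr 1; ring
  rw [h1, h2, h3, Real.rpow_add (by positivity), Real.rpow_neg (by positivity : 0 ≤ m / Ω) m,
    Real.div_rpow hm.le hΩ.le]
  have := Real.rpow_pos_of_pos hm m
  have := Real.rpow_pos_of_pos hΩ m
  field_simp

lemma nakagami_moment_one {m Ω : ℝ} (hm : 0 < m) (hΩ : 0 < Ω) :
    ∫ x, x ∂(nakagami m Ω) = Real.Gamma (m + 1 / 2) / Real.Gamma m * Real.sqrt (Ω / m) := by
  simpa using nakagami_moment hm hΩ 1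

lemma nakagami_moment_two {m Ω : ℝ} (hm : 0 < m) (hΩ : 0 < Ω) :
    ∫ x, x ^ 2 ∂(nakagami m Ω) = Ω := by
  have hG := (Real.Gamma_pos_of_pos hm).ne'
  rw [nakagami_moment hm hΩ 2, Real.sq_sqrt (by positivity)]
  norm_num
  rw [Real.Gamma_add_one hm.ne']
  field_simp

lemma nakagami_moment_four {m Ω : ℝ} (hm : 0 < m) (hΩ : 0 < Ω) :
    ∫ x, x ^ 4 ∂(nakagami m Ω) = Ω ^ 2 + Ω ^ 2 / m := by
  have hG := (Real.Gamma_pos_of_pos hm).ne'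
  rw [nakagami_moment hm hΩ 4, show Real.sqrt (Ω / m) ^ 4 = (Real.sqrt (Ω / m) ^ 2) ^ 2 by ring,
    Real.sq_sqrt (by positivity)]
  have : m + ((4 : ℕ) : ℝ) / 2 = m + 1 + 1 := by norm_num; ring
  rw [this, Real.Gamma_add_one (by positivity), Real.Gamma_add_one hm.ne']
  field_simp

lemma isProbabilityMeasure_nakagami {m Ω : ℝ} (hm : 0 < m) (hΩ : 0 < Ω) :
    IsProbabilityMeasure (nakagami m Ω) := by
  have h := nakagami_moment hm hΩ 0
  have hG := (Real.Gamma_pos_of_pos hm).ne'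
  -- The zeroth moment is the total mass as a real number; its value one also excludes infinite
  -- mass, which `toReal` sends to zero.
  simp only [pow_zero, integral_const, smul_eq_mul, mul_one, CharP.cast_eq_zero, zero_div,
    add_zero, div_self hG] at h
  have h' := (ENNReal.toReal_eq_one_iff _).1 h
  exact ⟨h'⟩

lemma nakagami_finiteMoments {m Ω : ℝ} (hm : 0 < m) (hΩ : 0 < Ω) :
    FiniteMoments (fun x => x) (nakagami m Ω) := by
  have := isProbabilityMeasure_nakagami hm hΩ
  refine FiniteMoments.of_integrable_pow aestronglyMeasurable_id fun n => ?_
  simpa using (nakagami_integrable_pow hm hΩ n).norm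

end Nakagami

/-! ### Gaussian moments up to order four. -/

section Gaussian

lemma gaussianReal_finiteMoments (v : ℝ≥0) : FiniteMoments (fun x => x) (gaussianReal 0 v) :=
  fun p => memLp_id_gaussianReal' p (by simp)

lemma gaussianReal_integral_pow_eq_iteratedDeriv (v : ℝ≥0) (n : ℕ) :
    ∫ x, x ^ n ∂(gaussianReal 0 v) =
      iteratedDeriv n (fun t : ℝ => Real.exp (v * t ^ 2 / 2)) 0 := by
  have h := iteratedDeriv_mgf_zero (X := id) (μ := gaussianReal 0 v)
    (by rw [integrableExpSet_id_gaussianReal]; simp) n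
  have h2 : mgf id (gaussianReal 0 v) = fun t : ℝ => Real.exp (v * t ^ 2 / 2) := by
    ext t
    rw [mgf_gaussianReal (μ := 0) (v := v) (by simp)]
    simp
  rw [h2] at h
  rw [h]
  simp

lemma gaussianReal_moments (v : ℝ≥0) :
    ∫ x, x ∂(gaussianReal 0 v) = 0 ∧ ∫ x, x ^ 2 ∂(gaussianReal 0 v) = v ∧
      ∫ x, x ^ 3 ∂(gaussianReal 0 v) = 0 ∧ ∫ x, x ^ 4 ∂(gaussianReal 0 v) = 3 * (v : ℝ) ^ 2 := by
  -- Derivatives of the moment generating function stay of the form polynomial times `exp (v t² /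
  -- 2)`; the rule `p ↦ p' + v t p` is iterated four times and evaluated at zero.
  have step (p q : ℝ → ℝ) (hp : ∀ t, HasDerivAt p (q t) t) :
      deriv (fun t => p t * Real.exp (v * t ^ 2 / 2)) =
        fun t => (q t + p t * (v * t)) * Real.exp (v * t ^ 2 / 2) := by
    ext t
    have h1 : HasDerivAt (fun t : ℝ => v * t ^ 2 / 2) (v * t) t := by
      have := (((hasDerivAt_id t).pow 2).const_mul (v : ℝ)).div_const 2
      convert! this using 1
      simp; ring
    refine ((hp t).mul h1.exp).deriv.trans ?_
    ring
  have d1 : deriv (fun t : ℝ => Real.exp (v * t ^ 2 / 2)) =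
      fun t => (v * t) * Real.exp (v * t ^ 2 / 2) := by
    simpa only [one_mul, zero_add] using step (fun _ => 1) (fun _ => 0) (fun t => hasDerivAt_const t _)
  have d2 := step (fun t => v * t) (fun _ => v)
    (fun t => by simpa using (hasDerivAt_id t).const_mul (v : ℝ))
  have d3 := step (fun t => v + v * t * (v * t)) (fun t => 2 * v ^ 2 * t) (fun t => by
    have := (((hasDerivAt_id t).const_mul (v : ℝ)).mul ((hasDerivAt_id t).const_mul (v : ℝ))).const_add
      (v : ℝ)
    convert! this using 1
    simp; ring)
  have d4 := step (fun t => 2 * v ^ 2 * t + (v + v * t * (v * t)) * (v * t))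
    (fun t => 2 * v ^ 2 + (2 * v ^ 2 * t * (v * t) + (v + v * t * (v * t)) * v)) (fun t => by
    have a := (hasDerivAt_id t).const_mul (v : ℝ)
    have := ((hasDerivAt_id t).const_mul (2 * (v : ℝ) ^ 2)).add (((a.mul a).const_add (v : ℝ)).mul a)
    convert! this using 1
    simp only [id_eq, Pi.mul_apply, mul_one]
    ring)
  refine ⟨?_, ?_, ?_, ?_⟩
  · simp
  · rw [gaussianReal_integral_pow_eq_iteratedDeriv, iteratedDeriv_succ', iteratedDeriv_one, d1, d2]
    simp
  · rw [gaussianReal_integral_pow_eq_iteratedDeriv, iteratedDeriv_succ', iteratedDeriv_succ',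
      iteratedDeriv_one, d1, d2, d3]
    simp
  · rw [gaussianReal_integral_pow_eq_iteratedDeriv, iteratedDeriv_succ', iteratedDeriv_succ',
      iteratedDeriv_succ', iteratedDeriv_one, d1, d2, d3, d4]
    simp; ring

end Gaussian

/-! ### Moments of the circular complex normal distribution. -/

section ComplexNormal

lemma continuous_re_add_im :
    Continuous fun p : ℝ × ℝ => (p.1 : ℂ) + (p.2 : ℂ) * Complex.I := by fun_prop

instance isProbabilityMeasure_complexNormal (v : ℝ≥0) :
    IsProbabilityMeasure (complexNormal v) :=
  Measure.isProbabilityMeasure_map continuous_re_add_im.aemeasurable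

lemma integral_complexNormal {E : Type*} [NormedAddCommGroup E] [NormedSpace ℝ E] (v : ℝ≥0)
    {f : ℂ → E} (hf : Continuous f) : ∫ z, f z ∂(complexNormal v) =
      ∫ p : ℝ × ℝ, f ((p.1 : ℂ) + (p.2 : ℂ) * Complex.I)
        ∂((gaussianReal 0 (v / 2)).prod (gaussianReal 0 (v / 2))) := by
  rw [complexNormal, integral_map continuous_re_add_im.aemeasurable]
  exact hf.aestronglyMeasurable

lemma complexNormal_finiteMoments (v : ℝ≥0) : FiniteMoments (fun z => z) (complexNormal v) := by
  refine finiteMoments_map continuous_re_add_im.aemeasurable aestronglyMeasurable_id ?_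
  have h := gaussianReal_finiteMoments (v / 2)
  exact (h.comp_fst _).ofReal.add ((h.comp_snd _).ofReal.mul (.const _))

lemma norm_re_add_im_sq (x y : ℝ) : ‖(x : ℂ) + (y : ℂ) * Complex.I‖ ^ 2 = x ^ 2 + y ^ 2 := by
  rw [← Complex.normSq_eq_norm_sq, Complex.normSq_add_mul_I]

lemma complexNormal_integral_id (v : ℝ≥0) : ∫ z, z ∂(complexNormal v) = 0 := by
  rw [integral_complexNormal v (f := fun z => z) continuous_id]
  have h := gaussianReal_finiteMoments (v / 2)
  obtain ⟨h1, -⟩ := gaussianReal_moments (v / 2)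
  rw [integral_add (h.comp_fst _).ofReal.integrable
      ((h.comp_snd _).ofReal.mul (.const _)).integrable, integral_mul_const, integral_complex_ofReal,
    integral_complex_ofReal, integral_fun_fst (fun x : ℝ => x), integral_fun_snd (fun x : ℝ => x), h1]
  simp

lemma complexNormal_integral_re (v : ℝ≥0) : ∫ z, z.re ∂(complexNormal v) = 0 := by
  rw [integral_complexNormal v Complex.continuous_re]
  obtain ⟨h1, -⟩ := gaussianReal_moments (v / 2)
  simp [integral_fun_fst (fun x : ℝ => x), h1]

lemma complexNormal_integral_re_sq (v : ℝ≥0) : ∫ z, z.re ^ 2 ∂(complexNormal v) = v / 2 := by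
  rw [integral_complexNormal v (by fun_prop)]
  obtain ⟨-, h2, -⟩ := gaussianReal_moments (v / 2)
  simp [integral_fun_fst (fun x : ℝ => x ^ 2), h2]

lemma complexNormal_integral_norm_sq (v : ℝ≥0) : ∫ z, ‖z‖ ^ 2 ∂(complexNormal v) = v := by
  rw [integral_complexNormal v (by fun_prop)]
  simp only [norm_re_add_im_sq]
  have h := gaussianReal_finiteMoments (v / 2)
  obtain ⟨-, h2, -⟩ := gaussianReal_moments (v / 2)
  rw [integral_add ((h.comp_fst _).pow 2).integrable ((h.comp_snd _).pow 2).integrable,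
    integral_fun_fst (fun x : ℝ => x ^ 2), integral_fun_snd (fun x : ℝ => x ^ 2), h2]
  simp

lemma complexNormal_integral_norm_four (v : ℝ≥0) :
    ∫ z, ‖z‖ ^ 4 ∂(complexNormal v) = 2 * (v : ℝ) ^ 2 := by
  rw [integral_complexNormal v (by fun_prop)]
  have e (x y : ℝ) : ‖(x : ℂ) + (y : ℂ) * Complex.I‖ ^ 4 =
      x ^ 4 + 2 * (x ^ 2 * y ^ 2) + y ^ 4 := by
    rw [show 4 = 2 * 2 by rfl, pow_mul, norm_re_add_im_sq]; ring
  simp only [e]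
  have h := gaussianReal_finiteMoments (v / 2)
  obtain ⟨-, h2, -, h4⟩ := gaussianReal_moments (v / 2)
  rw [integral_add (((h.comp_fst _).pow 4).add
      ((((h.comp_fst _).pow 2).mul ((h.comp_snd _).pow 2)).const_mul 2)).integrable
      ((h.comp_snd _).pow 4).integrable,
    integral_add ((h.comp_fst _).pow 4).integrable
      ((((h.comp_fst _).pow 2).mul ((h.comp_snd _).pow 2)).const_mul 2).integrable,
    integral_const_mul, integral_prod_mul (fun x : ℝ => x ^ 2) (fun x : ℝ => x ^ 2),
    integral_fun_fst (fun x : ℝ => x ^ 4), integral_fun_snd (fun x : ℝ => x ^ 4), h2, h4]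
  simp
  ring

/-- The integrand is odd in the real part. It occurs as a cross term in the fourth moment of a
Rician entry. -/
lemma complexNormal_integral_re_mul_norm_sq (v : ℝ≥0) :
    ∫ z, z.re * ‖z‖ ^ 2 ∂(complexNormal v) = 0 := by
  rw [integral_complexNormal v (by fun_prop)]
  have e (x y : ℝ) : ((x : ℂ) + (y : ℂ) * Complex.I).re * ‖(x : ℂ) + (y : ℂ) * Complex.I‖ ^ 2 =
      x ^ 3 + x * y ^ 2 := by
    rw [norm_re_add_im_sq]; simp; ring
  simp only [e]
  have h := gaussianReal_finiteMoments (v / 2)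
  obtain ⟨h1, h2, h3, -⟩ := gaussianReal_moments (v / 2)
  rw [integral_add ((h.comp_fst _).pow 3).integrable
      ((h.comp_fst _).mul ((h.comp_snd _).pow 2)).integrable,
    integral_prod_mul (fun x : ℝ => x) (fun x : ℝ => x ^ 2),
    integral_fun_fst (fun x : ℝ => x ^ 3), h1, h2, h3]
  simp

end ComplexNormal

/-! ### Moments of the Shadowed-Rician distribution. -/

section ShadowedRician

variable {m Ω : ℝ}

lemma continuous_ofReal_add : Continuous fun p : ℝ × ℂ => (p.1 : ℂ) + p.2 := by fun_prop

lemma isProbabilityMeasure_shadowedRician (hm : 0 < m) (hΩ : 0 < Ω) (b : ℝ≥0) :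
    IsProbabilityMeasure (shadowedRician m Ω b) :=
  have := isProbabilityMeasure_nakagami hm hΩ
  Measure.isProbabilityMeasure_map continuous_ofReal_add.aemeasurable

lemma integral_shadowedRician {E : Type*} [NormedAddCommGroup E] [NormedSpace ℝ E] (m Ω : ℝ)
    (b : ℝ≥0) {f : ℂ → E} (hf : Continuous f) : ∫ z, f z ∂(shadowedRician m Ω b) =
      ∫ p : ℝ × ℂ, f ((p.1 : ℂ) + p.2) ∂((nakagami m Ω).prod (complexNormal (2 * b))) := by
  rw [shadowedRician, integral_map continuous_ofReal_add.aemeasurable]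
  exact hf.aestronglyMeasurable

lemma shadowedRician_finiteMoments (hm : 0 < m) (hΩ : 0 < Ω) (b : ℝ≥0) :
    FiniteMoments (fun z => z) (shadowedRician m Ω b) := by
  have := isProbabilityMeasure_nakagami hm hΩ
  refine finiteMoments_map continuous_ofReal_add.aemeasurable aestronglyMeasurable_id ?_
  exact ((nakagami_finiteMoments hm hΩ).comp_fst _).ofReal.add
    ((complexNormal_finiteMoments _).comp_snd _)

lemma shadowedRician_integral_id (hm : 0 < m) (hΩ : 0 < Ω) (b : ℝ≥0) :
    ∫ z, z ∂(shadowedRician m Ω b) =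
      ((Real.Gamma (m + 1 / 2) / Real.Gamma m * Real.sqrt (Ω / m) : ℝ) : ℂ) := by
  have := isProbabilityMeasure_nakagami hm hΩ
  rw [integral_shadowedRician m Ω b (f := fun z => z) continuous_id]
  rw [integral_add ((nakagami_finiteMoments hm hΩ).comp_fst _).ofReal.integrable
      ((complexNormal_finiteMoments _).comp_snd _).integrable, integral_complex_ofReal,
    integral_fun_fst (fun x : ℝ => x), integral_fun_snd (fun x : ℂ => x),
    complexNormal_integral_id, nakagami_moment_one hm hΩ]
  simp

lemma norm_ofReal_add_sq (x : ℝ) (z : ℂ) :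
    ‖(x : ℂ) + z‖ ^ 2 = x ^ 2 + 2 * (x * z.re) + ‖z‖ ^ 2 := by
  simp only [← Complex.normSq_eq_norm_sq, Complex.normSq_apply, Complex.add_re, Complex.add_im,
    Complex.ofReal_re, Complex.ofReal_im]
  ring

lemma shadowedRician_integral_norm_sq (hm : 0 < m) (hΩ : 0 < Ω) (b : ℝ≥0) :
    ∫ z, ‖z‖ ^ 2 ∂(shadowedRician m Ω b) = 2 * b + Ω := by
  have := isProbabilityMeasure_nakagami hm hΩ
  rw [integral_shadowedRician m Ω b (by fun_prop)]
  simp only [norm_ofReal_add_sq]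
  have hx := (nakagami_finiteMoments hm hΩ).comp_fst (complexNormal (2 * b))
  have hz := (complexNormal_finiteMoments (2 * b)).comp_snd (nakagami m Ω)
  have hr : FiniteMoments (fun x : ℝ × ℂ => x.2.re)
      ((nakagami m Ω).prod (complexNormal (2 * b))) :=
    hz.mono (by fun_prop) fun x => Complex.abs_re_le_norm x.2
  rw [integral_add ((hx.pow 2).add ((hx.mul hr).const_mul 2)).integrable
      (hz.norm.pow 2).integrable,
    integral_add (hx.pow 2).integrable ((hx.mul hr).const_mul 2).integrable,
    integral_const_mul, integral_prod_mul (fun x : ℝ => x) (fun z : ℂ => z.re),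
    integral_fun_fst (fun x : ℝ => x ^ 2), integral_fun_snd (fun z : ℂ => ‖z‖ ^ 2),
    complexNormal_integral_re, complexNormal_integral_norm_sq, nakagami_moment_two hm hΩ]
  simp
  ring

lemma shadowedRician_integral_norm_four (hm : 0 < m) (hΩ : 0 < Ω) (b : ℝ≥0) :
    ∫ z, ‖z‖ ^ 4 ∂(shadowedRician m Ω b) =
      Ω ^ 2 + Ω ^ 2 / m + 8 * b * Ω + 8 * (b : ℝ) ^ 2 := by
  have := isProbabilityMeasure_nakagami hm hΩ
  rw [integral_shadowedRician m Ω b (by fun_prop)]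
  have e (x : ℝ) (z : ℂ) : ‖(x : ℂ) + z‖ ^ 4 = x ^ 4 * 1 + 4 * (x ^ 2 * z.re ^ 2) + 1 * ‖z‖ ^ 4
      + 4 * (x ^ 3 * z.re) + 2 * (x ^ 2 * ‖z‖ ^ 2) + 4 * (x * (z.re * ‖z‖ ^ 2)) := by
    rw [show 4 = 2 * 2 by rfl, pow_mul, norm_ofReal_add_sq]; ring
  simp only [e]
  have hx := (nakagami_finiteMoments hm hΩ).comp_fst (complexNormal (2 * b))
  have hz := (complexNormal_finiteMoments (2 * b)).comp_snd (nakagami m Ω)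
  have hr : FiniteMoments (fun x : ℝ × ℂ => x.2.re)
      ((nakagami m Ω).prod (complexNormal (2 * b))) :=
    hz.mono (by fun_prop) fun x => Complex.abs_re_le_norm x.2
  have f1 := (hx.pow 4).mul (FiniteMoments.const (1 : ℝ))
  have f2 := ((hx.pow 2).mul (hr.pow 2)).const_mul 4
  have f3 := (FiniteMoments.const (1 : ℝ)).mul (hz.norm.pow 4)
  have f4 := ((hx.pow 3).mul hr).const_mul 4
  have f5 := ((hx.pow 2).mul (hz.norm.pow 2)).const_mul 2
  have f6 := (hx.mul (hr.mul (hz.norm.pow 2))).const_mul 4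
  rw [integral_add ((((f1.add f2).add f3).add f4).add f5).integrable f6.integrable,
    integral_add (((f1.add f2).add f3).add f4).integrable f5.integrable,
    integral_add ((f1.add f2).add f3).integrable f4.integrable,
    integral_add (f1.add f2).integrable f3.integrable,
    integral_add f1.integrable f2.integrable]
  simp only [integral_const_mul, integral_mul_const]
  rw [integral_prod_mul (fun x : ℝ => x) (fun z : ℂ => z.re * ‖z‖ ^ 2),
    integral_prod_mul (fun x : ℝ => x ^ 2) (fun z : ℂ => ‖z‖ ^ 2),
    integral_prod_mul (fun x : ℝ => x ^ 3) (fun z : ℂ => z.re),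
    integral_prod_mul (fun x : ℝ => x ^ 2) (fun z : ℂ => z.re ^ 2),
    integral_fun_fst (fun x : ℝ => x ^ 4), integral_fun_snd (fun z : ℂ => ‖z‖ ^ 4),
    complexNormal_integral_re, complexNormal_integral_norm_sq, nakagami_moment_two hm hΩ,
    nakagami_moment_four hm hΩ, complexNormal_integral_norm_four, complexNormal_integral_re_sq,
    complexNormal_integral_re_mul_norm_sq]
  simp
  ring

end ShadowedRician

/-! ### Second and fourth moments of sums of independent centred variables. -/

section IndependentSums

variable {α ι : Type*} {mα : MeasurableSpace α} {P : Measure α}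

lemma sq_integral_le_integral_sq [IsProbabilityMeasure P] {f : α → ℝ} (hf : FiniteMoments f P) :
    (∫ x, f x ∂P) ^ 2 ≤ ∫ x, f x ^ 2 ∂P := by
  have h := variance_eq_sub hf.memLp_two
  have h0 := variance_nonneg f P
  simp only [Pi.pow_apply] at h
  linarith

lemma norm_add_sq_eq (a b : ℂ) : ‖a + b‖ ^ 2 = ‖a‖ ^ 2 + 2 * (a * star b).re + ‖b‖ ^ 2 := by
  simp only [← Complex.normSq_eq_norm_sq, Complex.normSq_apply, Complex.add_re, Complex.add_im,
    Complex.mul_re, Complex.star_def, Complex.conj_re, Complex.conj_im]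
  ring

lemma sq_re_mul_star_le (a b : ℂ) : (a * star b).re ^ 2 ≤ ‖a‖ ^ 2 * ‖b‖ ^ 2 := by
  rw [← mul_pow, ← sq_abs]
  have := Complex.abs_re_le_norm (a * star b)
  rw [norm_mul, norm_star] at this
  gcongr

/-- With `t = Re (a b̄)`, expand `(|a|² + 2t + |b|²)²` and use `t² ≤ |a|² |b|²`. The terms `|a|² t`
and `|b|² t` are kept exactly, as products of a function of `a` and a function of `b`, because they
integrate to zero for independent centred variables. -/
lemma norm_add_four_le (a b : ℂ) : ‖a + b‖ ^ 4 ≤ ‖a‖ ^ 4 + 6 * (‖a‖ ^ 2 * ‖b‖ ^ 2) + ‖b‖ ^ 4 +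
    4 * (((‖a‖ ^ 2 : ℝ) * a) * star b).re + 4 * (a * ((‖b‖ ^ 2 : ℝ) * star b)).re := by
  have h1 : ‖a + b‖ ^ 4 = (‖a‖ ^ 2 + 2 * (a * star b).re + ‖b‖ ^ 2) ^ 2 := by
    rw [← norm_add_sq_eq]; ring
  have h2 : (((‖a‖ ^ 2 : ℝ) * a) * star b).re = ‖a‖ ^ 2 * (a * star b).re := by
    rw [mul_assoc, Complex.re_ofReal_mul]
  have h3 : (a * ((‖b‖ ^ 2 : ℝ) * star b)).re = ‖b‖ ^ 2 * (a * star b).re := by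
    rw [mul_left_comm, Complex.re_ofReal_mul]
  rw [h1, h2, h3]
  nlinarith [sq_re_mul_star_le a b]

lemma FiniteMoments.re {f : α → ℂ} (hf : FiniteMoments f P) :
    FiniteMoments (fun x => (f x).re) P :=
  hf.mono (Complex.continuous_re.comp_aestronglyMeasurable hf.aestronglyMeasurable)
    fun x => Complex.abs_re_le_norm (f x)

lemma integral_complex_re {f : α → ℂ} (hf : FiniteMoments f P) :
    ∫ x, (f x).re ∂P = (∫ x, f x ∂P).re := integral_re hf.integrable

lemma integral_star_eq (f : α → ℂ) : ∫ x, star (f x) ∂P = star (∫ x, f x ∂P) :=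
  integral_conj

variable [IsProbabilityMeasure P]

lemma ProbabilityTheory.IndepFun.integral_norm_add_sq {X Y : α → ℂ} (h : X ⟂ᵢ[P] Y)
    (hX : FiniteMoments X P) (hY : FiniteMoments Y P) (hX0 : ∫ x, X x ∂P = 0) :
    ∫ x, ‖X x + Y x‖ ^ 2 ∂P = ∫ x, ‖X x‖ ^ 2 ∂P + ∫ x, ‖Y x‖ ^ 2 ∂P := by
  have hs : (fun x => X x) ⟂ᵢ[P] fun x => star (Y x) := h.comp measurable_id continuous_star.measurable
  have f1 := hX.norm.pow 2
  have f2 := (hX.mul hY.conj).re.const_mul 2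
  have f3 := hY.norm.pow 2
  simp only [norm_add_sq_eq]
  rw [integral_add (f1.add f2).integrable f3.integrable,
    integral_add f1.integrable f2.integrable, integral_const_mul,
    integral_complex_re (hX.mul hY.conj),
    hs.integral_fun_mul_eq_mul_integral hX.aestronglyMeasurable hY.conj.aestronglyMeasurable, hX0]
  simp

lemma ProbabilityTheory.IndepFun.integral_norm_add_four_le {X Y : α → ℂ} (h : X ⟂ᵢ[P] Y)
    (hX : FiniteMoments X P) (hY : FiniteMoments Y P) (hX0 : ∫ x, X x ∂P = 0)
    (hY0 : ∫ x, Y x ∂P = 0) :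
    ∫ x, ‖X x + Y x‖ ^ 4 ∂P ≤ ∫ x, ‖X x‖ ^ 4 ∂P
      + 6 * ((∫ x, ‖X x‖ ^ 2 ∂P) * ∫ x, ‖Y x‖ ^ 2 ∂P) + ∫ x, ‖Y x‖ ^ 4 ∂P := by
  have i1 : (fun x => ‖X x‖ ^ 2) ⟂ᵢ[P] fun x => ‖Y x‖ ^ 2 :=
    h.comp (φ := fun z : ℂ => ‖z‖ ^ 2) (ψ := fun z : ℂ => ‖z‖ ^ 2) (by fun_prop) (by fun_prop)
  have i2 : (fun x => (‖X x‖ ^ 2 : ℝ) * X x) ⟂ᵢ[P] fun x => star (Y x) :=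
    h.comp (φ := fun z : ℂ => (‖z‖ ^ 2 : ℝ) * z) (ψ := star) (by fun_prop) continuous_star.measurable
  have i3 : X ⟂ᵢ[P] fun x => (‖Y x‖ ^ 2 : ℝ) * star (Y x) :=
    h.comp (φ := fun z : ℂ => z) (ψ := fun z : ℂ => (‖z‖ ^ 2 : ℝ) * star z) measurable_id
      (Continuous.measurable (by fun_prop))
  have f1 := hX.norm.pow 4
  have f2 := ((hX.norm.pow 2).mul (hY.norm.pow 2)).const_mul 6
  have f3 := hY.norm.pow 4
  have g4 := (hX.norm.pow 2).ofReal.mul hX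
  have g5 := (hY.norm.pow 2).ofReal.mul hY.conj
  have f4 := (g4.mul hY.conj).re.const_mul 4
  have f5 := (hX.mul g5).re.const_mul 4
  refine (integral_mono ((hX.add hY).norm.pow 4).integrable
    ((((f1.add f2).add f3).add f4).add f5).integrable
    fun x => norm_add_four_le (X x) (Y x)).trans_eq ?_
  rw [integral_add (((f1.add f2).add f3).add f4).integrable f5.integrable,
    integral_add ((f1.add f2).add f3).integrable f4.integrable,
    integral_add (f1.add f2).integrable f3.integrable,
    integral_add f1.integrable f2.integrable]
  simp only [integral_const_mul]
  rw [integral_complex_re (g4.mul hY.conj), integral_complex_re (hX.mul g5),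
    i1.integral_fun_mul_eq_mul_integral (hX.norm.pow 2).aestronglyMeasurable
      (hY.norm.pow 2).aestronglyMeasurable,
    i2.integral_fun_mul_eq_mul_integral g4.aestronglyMeasurable hY.conj.aestronglyMeasurable,
    i3.integral_fun_mul_eq_mul_integral hX.aestronglyMeasurable g5.aestronglyMeasurable,
    integral_star_eq, hX0, hY0]
  simp

variable {Y : ι → α → ℂ} (hm : ∀ i, Measurable (Y i)) (hY : ∀ i, FiniteMoments (Y i) P)
  (hind : iIndepFun Y P) (h0 : ∀ i, ∫ x, Y i x ∂P = 0)

include hY h0 in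
omit [IsProbabilityMeasure P] in
lemma integral_sum_eq_zero (s : Finset ι) : ∫ x, ∑ i ∈ s, Y i x ∂P = 0 := by
  rw [integral_finsetSum s fun i _ => (hY i).integrable]
  exact Finset.sum_eq_zero fun i _ => h0 i

include hm hY hind h0

lemma integral_norm_sum_sq (s : Finset ι) :
    ∫ x, ‖∑ i ∈ s, Y i x‖ ^ 2 ∂P = ∑ i ∈ s, ∫ x, ‖Y i x‖ ^ 2 ∂P := by
  classical
  induction s using Finset.induction_on with
  | empty => simp
  | insert i s hi ih =>
    have h := hind.indepFun_finsetSum_of_notMem hm hi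
    have e : (∑ j ∈ s, Y j) = fun x => ∑ j ∈ s, Y j x := by ext x; simp
    rw [e] at h
    simp only [Finset.sum_insert hi, add_comm (Y i _)]
    rw [h.integral_norm_add_sq (.sum fun i _ => hY i) (hY i) (integral_sum_eq_zero hY h0 s), ih,
      add_comm]

/-- Adding one variable of weight `w` to a sum of total weight `U` costs at most the cross term `6 κ
U w` and `κ w²`, and `3 κ (U + w)²` has room for both. -/
lemma integral_norm_sum_four_le {κ : ℝ} {w : ι → ℝ} (hw : ∀ i, 0 ≤ w i)
    (h4 : ∀ i, ∫ x, ‖Y i x‖ ^ 4 ∂P ≤ κ * w i ^ 2) (hκ : 0 ≤ κ) (s : Finset ι) :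
    ∫ x, ‖∑ i ∈ s, Y i x‖ ^ 4 ∂P ≤ 3 * κ * (∑ i ∈ s, w i) ^ 2 := by
  classical
  -- The squared second moment is at most the fourth moment.
  have h2 (i : ι) : ∫ x, ‖Y i x‖ ^ 2 ∂P ≤ Real.sqrt κ * w i := by
    refine abs_le_of_sq_le_sq' ?_ (mul_nonneg (Real.sqrt_nonneg _) (hw i)) |>.2
    rw [mul_pow, Real.sq_sqrt hκ]
    refine (sq_integral_le_integral_sq ((hY i).norm.pow 2)).trans ?_
    simpa only [← pow_mul] using h4 i
  induction s using Finset.induction_on with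
  | empty => simp
  | insert i s hi ih =>
    have h := hind.indepFun_finsetSum_of_notMem hm hi
    have e : (∑ j ∈ s, Y j) = fun x => ∑ j ∈ s, Y j x := by ext x; simp
    rw [e] at h
    simp only [Finset.sum_insert hi, add_comm (Y i _)]
    refine (h.integral_norm_add_four_le (.sum fun i _ => hY i) (hY i)
      (integral_sum_eq_zero hY h0 s) (h0 i)).trans ?_
    have hU : 0 ≤ ∑ j ∈ s, w j := Finset.sum_nonneg fun j _ => hw j
    have h5 : (∫ x, ‖∑ j ∈ s, Y j x‖ ^ 2 ∂P) * ∫ x, ‖Y i x‖ ^ 2 ∂P ≤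
        (Real.sqrt κ * ∑ j ∈ s, w j) * (Real.sqrt κ * w i) := by
      refine mul_le_mul ?_ (h2 i) (by positivity) (by positivity)
      rw [integral_norm_sum_sq hm hY hind h0 s, Finset.mul_sum]
      exact Finset.sum_le_sum fun j _ => h2 j
    have h6 : (Real.sqrt κ * ∑ j ∈ s, w j) * (Real.sqrt κ * w i) = κ * (∑ j ∈ s, w j) * w i := by
      rw [mul_mul_mul_comm, Real.mul_self_sqrt hκ, mul_assoc]
    rw [h6] at h5
    nlinarith [h4 i, mul_nonneg hκ (sq_nonneg (w i))]

end IndependentSums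

/-! ### The matched filter output for a fixed vector and a random channel. -/

section MatchedFilter

variable {ι : Type*} [Fintype ι] {μ : Measure ℂ} [IsProbabilityMeasure μ]
  (hμ : FiniteMoments (fun z => z) μ) {c : ℂ} (hc : ∫ z, z ∂μ = c)

/-- Separates the deterministic mean of the filter output from a sum of independent centred terms.
-/
lemma dotProduct_star_eq (u x : ι → ℂ) (c : ℂ) :
    u ⬝ᵥ star x = (∑ t, u t) * star c + ∑ t, u t * star (x t - c) := by
  rw [Finset.sum_mul, ← Finset.sum_add_distrib]
  refine Finset.sum_congr rfl fun t _ => ?_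
  simp [mul_sub]

include hμ hc

lemma integral_norm_sub_mean_sq :
    ∫ z, ‖z - c‖ ^ 2 ∂μ = ∫ z, ‖z‖ ^ 2 ∂μ - ‖c‖ ^ 2 := by
  have e (z : ℂ) : ‖z - c‖ ^ 2 = ‖z‖ ^ 2 - 2 * (z * star c).re + ‖c‖ ^ 2 := by
    rw [sub_eq_add_neg, norm_add_sq_eq]; simp; ring
  have f := (hμ.mul (.const (star c))).re.const_mul 2
  simp only [e]
  rw [integral_add ((hμ.norm.pow 2).sub f).integrable (integrable_const _),
    integral_sub (hμ.norm.pow 2).integrable f.integrable, integral_const_mul,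
    integral_complex_re (hμ.mul (.const _)), integral_mul_const, hc]
  simp only [integral_const, probReal_univ, one_smul, Complex.star_def, Complex.mul_conj,
    Complex.ofReal_re, Complex.normSq_eq_norm_sq]
  ring

lemma centered_matchedFilter (u : ι → ℂ) :
    (∀ t, Measurable fun x : ι → ℂ => u t * star (x t - c)) ∧
    (∀ t, FiniteMoments (fun x : ι → ℂ => u t * star (x t - c)) (Measure.pi fun _ => μ)) ∧
    iIndepFun (fun t (x : ι → ℂ) => u t * star (x t - c)) (Measure.pi fun _ => μ) ∧
    (∀ t, ∫ x : ι → ℂ, u t * star (x t - c) ∂(Measure.pi fun _ => μ) = 0) ∧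
    (∀ t, ∀ p : ℕ, ∫ x : ι → ℂ, ‖u t * star (x t - c)‖ ^ p ∂(Measure.pi fun _ => μ) =
      ‖u t‖ ^ p * ∫ z, ‖z - c‖ ^ p ∂μ) := by
  have hcont (t : ι) : Continuous fun z : ℂ => u t * star (z - c) :=
    continuous_const.mul (continuous_star.comp (continuous_id.sub continuous_const))
  have hf := hμ.sub (.const c)
  have hi := iIndepFun_pi (ι := ι) (Ω := fun _ => ℂ) (μ := fun _ => μ) (𝓧 := fun _ => ℂ)
    (X := fun t z => u t * star (z - c)) fun t => (hcont t).measurable.aemeasurable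
  have hF (t : ι) := FiniteMoments.comp_eval (ι := ι) (X := fun _ => ℂ) (μ := fun _ => μ) (i := t)
    (f := fun z : ℂ => u t * star (z - c)) (hf.conj.const_mul _)
  have hI (t : ι) := integral_comp_eval (ι := ι) (X := fun _ => ℂ) (μ := fun _ => μ) (i := t)
    (f := fun z : ℂ => u t * star (z - c)) (hcont t).aestronglyMeasurable
  have hN (t : ι) (p : ℕ) := integral_comp_eval (ι := ι) (X := fun _ => ℂ) (μ := fun _ => μ)
    (i := t) (f := fun z : ℂ => ‖u t * star (z - c)‖ ^ p)
    ((hcont t).norm.pow p).aestronglyMeasurable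
  refine ⟨fun t => (hcont t).measurable.comp (measurable_pi_apply t), hF, hi, fun t => ?_,
    fun t p => ?_⟩
  · rw [hI t, integral_const_mul, integral_star_eq,
      integral_sub hμ.integrable (integrable_const _), hc]
    simp
  · rw [hN t p, ← integral_const_mul]
    simp only [norm_mul, mul_pow, norm_star]

lemma integral_norm_add_dotProduct_sq (u : ι → ℂ) (d : ℂ) :
    ∫ x : ι → ℂ, ‖d + u ⬝ᵥ star x‖ ^ 2 ∂(Measure.pi fun _ => μ) =
      ‖d + (∑ t, u t) * star c‖ ^ 2
        + (∑ t, ‖u t‖ ^ 2) * (∫ z, ‖z‖ ^ 2 ∂μ - ‖c‖ ^ 2) := by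
  obtain ⟨h1, h2, h3, h4, h5⟩ := centered_matchedFilter hμ hc u
  have hη : FiniteMoments (fun x : ι → ℂ => ∑ t, u t * star (x t - c))
    (Measure.pi fun _ => μ) := .sum fun t _ => h2 t
  simp only [dotProduct_star_eq u _ c, ← add_assoc]
  set a := d + (∑ t, u t) * star c
  have f := ((FiniteMoments.const a).mul hη.conj).re.const_mul 2
  simp only [norm_add_sq_eq a]
  rw [integral_add ((FiniteMoments.const _).add f).integrable (hη.norm.pow 2).integrable,
    integral_add (integrable_const _) f.integrable, integral_const_mul,
    integral_complex_re ((FiniteMoments.const a).mul hη.conj), integral_const_mul,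
    integral_star_eq, integral_sum_eq_zero h2 h4, integral_norm_sum_sq h1 h2 h3 h4]
  simp only [h5, integral_norm_sub_mean_sq hμ hc, ← Finset.sum_mul]
  simp

lemma integral_norm_dotProduct_sq (u : ι → ℂ) :
    ∫ x : ι → ℂ, ‖u ⬝ᵥ star x‖ ^ 2 ∂(Measure.pi fun _ => μ) =
      ‖∑ t, u t‖ ^ 2 * ‖c‖ ^ 2 + (∑ t, ‖u t‖ ^ 2) * (∫ z, ‖z‖ ^ 2 ∂μ - ‖c‖ ^ 2) := by
  simpa [mul_pow] using integral_norm_add_dotProduct_sq hμ hc u 0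

lemma integral_sq_norm_dotProduct_sq_sub_le (u : ι → ℂ) :
    ∫ x : ι → ℂ, (‖u ⬝ᵥ star x‖ ^ 2 - (‖∑ t, u t‖ ^ 2 * ‖c‖ ^ 2
        + (∑ t, ‖u t‖ ^ 2) * (∫ z, ‖z‖ ^ 2 ∂μ - ‖c‖ ^ 2))) ^ 2 ∂(Measure.pi fun _ => μ) ≤
      8 * (‖∑ t, u t‖ ^ 2 * ‖c‖ ^ 2) * ((∑ t, ‖u t‖ ^ 2) * (∫ z, ‖z‖ ^ 2 ∂μ - ‖c‖ ^ 2))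
        + 6 * (∫ z, ‖z - c‖ ^ 4 ∂μ) * (∑ t, ‖u t‖ ^ 2) ^ 2 := by
  obtain ⟨h1, h2, h3, h4, h5⟩ := centered_matchedFilter hμ hc u
  have hη : FiniteMoments (fun x : ι → ℂ => ∑ t, u t * star (x t - c))
    (Measure.pi fun _ => μ) := .sum fun t _ => h2 t
  have e2 : ∫ x : ι → ℂ, ‖∑ t, u t * star (x t - c)‖ ^ 2 ∂(Measure.pi fun _ => μ) =
      (∑ t, ‖u t‖ ^ 2) * (∫ z, ‖z‖ ^ 2 ∂μ - ‖c‖ ^ 2) := by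
    rw [integral_norm_sum_sq h1 h2 h3 h4]
    simp only [h5, integral_norm_sub_mean_sq hμ hc, ← Finset.sum_mul]
  have e4 : ∫ x : ι → ℂ, ‖∑ t, u t * star (x t - c)‖ ^ 4 ∂(Measure.pi fun _ => μ) ≤
      3 * (∫ z, ‖z - c‖ ^ 4 ∂μ) * (∑ t, ‖u t‖ ^ 2) ^ 2 := by
    refine integral_norm_sum_four_le h1 h2 h3 h4 (fun t => sq_nonneg ‖u t‖) (fun t => ?_)
      (by positivity) _
    rw [h5]
    exact le_of_eq (by ring)
  simp only [dotProduct_star_eq u _ c]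
  have ha : ‖∑ t, u t‖ ^ 2 * ‖c‖ ^ 2 = ‖(∑ t, u t) * star c‖ ^ 2 := by simp [mul_pow]
  rw [ha, ← e2]
  set a := (∑ t, u t) * star c
  set η := fun x : ι → ℂ => ∑ t, u t * star (x t - c)
  set v := ∫ x, ‖η x‖ ^ 2 ∂(Measure.pi fun _ => μ)
  -- The deviation is `2 Re (a η̄) + (|η|² - v)`; apply `(x + y)² ≤ 2x² + 2y²` and `Re (a η̄)² ≤
  -- |a|² |η|²`. As `v` is the mean of `|η|²`, the last bracket integrates to `E|η|⁴ - v²`.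
  have hb (x : ι → ℂ) : (‖a + η x‖ ^ 2 - (‖a‖ ^ 2 + v)) ^ 2 ≤
      8 * ‖a‖ ^ 2 * ‖η x‖ ^ 2 + 2 * (‖η x‖ ^ 4 + v ^ 2 - 2 * v * ‖η x‖ ^ 2) := by
    rw [norm_add_sq_eq]
    nlinarith [sq_re_mul_star_le a (η x),
      sq_nonneg (2 * (a * star (η x)).re - (‖η x‖ ^ 2 - v))]
  have f2 := hη.norm.pow 2
  have f4 := hη.norm.pow 4
  have g1 := f2.const_mul (8 * ‖a‖ ^ 2)
  have g2 := (f4.add (.const (v ^ 2))).sub (f2.const_mul (2 * v))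
  refine (integral_mono ((((((FiniteMoments.const a).add hη).norm.pow 2).sub (.const _)).pow
    2).integrable) (g1.add (g2.const_mul 2)).integrable hb).trans ?_
  rw [integral_add g1.integrable (g2.const_mul 2).integrable, integral_const_mul,
    integral_const_mul, integral_sub (f4.add (.const (v ^ 2))).integrable
      (f2.const_mul (2 * v)).integrable, integral_add f4.integrable (integrable_const _),
    integral_const_mul]
  simp only [integral_const, probReal_univ, one_smul]
  change 8 * ‖a‖ ^ 2 * v + 2 * (∫ x, ‖η x‖ ^ 4 ∂(Measure.pi fun _ => μ) + v ^ 2 - 2 * v * v) ≤ _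
  nlinarith [sq_nonneg v]

end MatchedFilter

lemma MeasureTheory.MeasurePreserving.integral_comp_of_aestronglyMeasurable {α β E : Type*}
    {mα : MeasurableSpace α} {mβ : MeasurableSpace β} {μ : Measure α} {ν : Measure β}
    [NormedAddCommGroup E] [NormedSpace ℝ E] {g : α → β} (hg : MeasurePreserving g μ ν)
    {f : β → E} (hf : AEStronglyMeasurable f ν) : ∫ x, f (g x) ∂μ = ∫ y, f y ∂ν := by
  rw [← hg.map_eq] at hf ⊢
  exact (integral_map hg.aemeasurable hf).symm

/-! ### Relative variance and the Jensen gap of the logarithm. -/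

section RelativeVariance

variable {α β : Type*} {mα : MeasurableSpace α} {mβ : MeasurableSpace β} {P : Measure α}

/-- A random variable with finite moments, nonnegative mean, and variance at most `δ` times the
square of its mean. -/
structure HasRelVarLE (f : α → ℝ) (P : Measure α) (δ : ℝ) : Prop where
  finiteMoments : FiniteMoments f P
  integral_nonneg : 0 ≤ ∫ x, f x ∂P
  integral_sq_sub_le : ∫ x, (f x - ∫ y, f y ∂P) ^ 2 ∂P ≤ δ * (∫ x, f x ∂P) ^ 2

lemma HasRelVarLE.comp {P' : Measure β} {f : α → ℝ} {δ : ℝ} (hf : HasRelVarLE f P δ)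
    {g : β → α} (hg : MeasurePreserving g P' P) : HasRelVarLE (fun x => f (g x)) P' δ := by
  have h := hg.integral_comp_of_aestronglyMeasurable hf.finiteMoments.aestronglyMeasurable
  refine ⟨hf.finiteMoments.comp hg, ?_, ?_⟩
  · rw [h]; exact hf.2
  · rw [h, hg.integral_comp_of_aestronglyMeasurable (f := fun x => (f x - ∫ y, f y ∂P) ^ 2)
      ((hf.finiteMoments.aestronglyMeasurable.sub aestronglyMeasurable_const).pow 2)]
    exact hf.3

lemma HasRelVarLE.mono {f : α → ℝ} {δ δ' : ℝ} (hf : HasRelVarLE f P δ) (h : δ ≤ δ') :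
    HasRelVarLE f P δ' :=
  ⟨hf.1, hf.2, hf.3.trans (by gcongr)⟩

lemma HasRelVarLE.const_mul [IsFiniteMeasure P] {f : α → ℝ} {δ a : ℝ} (ha : 0 ≤ a)
    (hf : HasRelVarLE f P δ) : HasRelVarLE (fun x => a * f x) P δ := by
  refine ⟨hf.1.const_mul a, ?_, ?_⟩
  · rw [integral_const_mul]; exact mul_nonneg ha hf.2
  · simp only [integral_const_mul, ← mul_sub, mul_pow]
    nlinarith [hf.3, mul_le_mul_of_nonneg_left hf.3 (sq_nonneg a)]

variable [IsProbabilityMeasure P]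

/-- The variance is unchanged and the mean only grows, so noise never worsens the bound. -/
lemma HasRelVarLE.const_add {f : α → ℝ} {δ a : ℝ} (ha : 0 ≤ a) (hδ : 0 ≤ δ)
    (hf : HasRelVarLE f P δ) : HasRelVarLE (fun x => a + f x) P δ := by
  have e : ∫ x, a + f x ∂P = a + ∫ x, f x ∂P := by
    rw [integral_add (integrable_const _) hf.1.integrable]; simp
  refine ⟨(FiniteMoments.const a).add hf.1, ?_, ?_⟩
  · rw [e]; exact add_nonneg ha hf.2
  · simp only [e, add_sub_add_left_eq_sub]
    refine hf.3.trans ?_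
    have := hf.2
    gcongr
    linarith

/-- No independence is needed: `(x + y)² ≤ 2x² + 2y²`, and `a² + b² ≤ (a + b)²` because both means
are nonnegative. -/
lemma HasRelVarLE.add {f g : α → ℝ} {δ : ℝ} (hδ : 0 ≤ δ) (hf : HasRelVarLE f P δ)
    (hg : HasRelVarLE g P δ) : HasRelVarLE (fun x => f x + g x) P (2 * δ) := by
  have e : ∫ x, f x + g x ∂P = ∫ x, f x ∂P + ∫ x, g x ∂P :=
    integral_add hf.1.integrable hg.1.integrable
  have hf0 := hf.2
  have hg0 := hg.2
  refine ⟨hf.1.add hg.1, by rw [e]; positivity, ?_⟩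
  rw [e]
  set a := ∫ x, f x ∂P
  set b := ∫ x, g x ∂P
  have f1 := ((hf.1.sub (.const a)).pow 2).const_mul 2
  have f2 := ((hg.1.sub (.const b)).pow 2).const_mul 2
  calc ∫ x, (f x + g x - (a + b)) ^ 2 ∂P
      ≤ ∫ x, 2 * (f x - a) ^ 2 + 2 * (g x - b) ^ 2 ∂P := by
        refine integral_mono (((hf.1.add hg.1).sub (.const (a + b))).pow 2).integrable
          (f1.add f2).integrable fun x => ?_
        nlinarith [sq_nonneg ((f x - a) - (g x - b))]
    _ = 2 * ∫ x, (f x - a) ^ 2 ∂P + 2 * ∫ x, (g x - b) ^ 2 ∂P := by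
        rw [integral_add f1.integrable f2.integrable, integral_const_mul, integral_const_mul]
    _ ≤ 2 * δ * (a + b) ^ 2 := by
        nlinarith [hf.3, hg.3, mul_nonneg hδ (mul_nonneg hf0 hg0)]

lemma integral_sq_sub_integral_le {f : α → ℝ} (hf : FiniteMoments f P) (a : ℝ) :
    ∫ x, (f x - ∫ y, f y ∂P) ^ 2 ∂P ≤ ∫ x, (f x - a) ^ 2 ∂P := by
  have e (b : ℝ) : ∫ x, (f x - b) ^ 2 ∂P = ∫ x, f x ^ 2 ∂P - 2 * b * ∫ x, f x ∂P + b ^ 2 := by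
    have e1 (x : α) : (f x - b) ^ 2 = f x ^ 2 - 2 * b * f x + b ^ 2 := by ring
    simp only [e1]
    rw [integral_add ((hf.pow 2).sub (hf.const_mul _)).integrable (integrable_const _),
      integral_sub (hf.pow 2).integrable (hf.const_mul _).integrable, integral_const_mul]
    simp
  rw [e, e]
  nlinarith [sq_nonneg (a - ∫ x, f x ∂P)]

/-- The mean minimizes the mean square deviation, so a convenient centre `a` may replace it, and a
lower bound `b` of the mean suffices on the right. -/
lemma HasRelVarLE.of_integral_sq_sub_le {f : α → ℝ} (hf : FiniteMoments f P) {a b δ : ℝ}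
    (hδ : 0 ≤ δ) (hb : 0 ≤ b) (hbf : b ≤ ∫ x, f x ∂P)
    (h : ∫ x, (f x - a) ^ 2 ∂P ≤ δ * b ^ 2) : HasRelVarLE f P δ :=
  ⟨hf, hb.trans hbf, (integral_sq_sub_integral_le hf a).trans (h.trans (by gcongr))⟩

/-- A second-order lower bound for the logarithm down to `exp (-L)`. For `r ≥ 1/2` it follows from
`log r ≥ 1 - 1/r`; below `1/2`, `4 (r - 1)² ≥ 1`, so the term with `L` alone covers the logarithm.
-/
lemma log_lower_bound {r L : ℝ} (hr : 0 < r) (hL : 0 ≤ L) (hLr : -L ≤ Real.log r) :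
    (r - 1) - (2 + 4 * L) * (r - 1) ^ 2 ≤ Real.log r := by
  rcases le_total (1 / 2) r with h | h
  · have h1 : 1 - r⁻¹ ≤ Real.log r := Real.one_sub_inv_le_log_of_pos hr
    have h2 : 1 - r⁻¹ = (r - 1) - (r - 1) ^ 2 / r := by field_simp; ring
    have h3 : (r - 1) ^ 2 / r ≤ 2 * (r - 1) ^ 2 := by
      rw [div_le_iff₀ hr]; nlinarith [sq_nonneg (r - 1)]
    nlinarith [mul_nonneg hL (sq_nonneg (r - 1))]
  · have : 1 / 4 ≤ (r - 1) ^ 2 := by nlinarith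
    nlinarith

omit [IsProbabilityMeasure P] in
lemma FiniteMoments.integrable_log [IsFiniteMeasure P] {f : α → ℝ} {σ : ℝ}
    (hf : FiniteMoments f P) (hσ : 0 < σ) (hσf : ∀ x, σ ≤ f x) :
    Integrable (fun x => Real.log (f x)) P := by
  refine Integrable.mono' (g := fun x => f x + |Real.log σ|)
    (hf.integrable.add (integrable_const _))
    (Real.measurable_log.comp_aemeasurable
      hf.aestronglyMeasurable.aemeasurable).aestronglyMeasurable (.of_forall fun x => ?_)
  have hpos : 0 < f x := hσ.trans_le (hσf x)
  rw [Real.norm_eq_abs, abs_le]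
  have h1 := Real.log_le_log hσ (hσf x)
  have h2 := Real.log_le_sub_one_of_pos hpos
  have h3 := neg_abs_le (Real.log σ)
  have h4 := abs_nonneg (Real.log σ)
  constructor <;> linarith

/-- The Jensen gap of the logarithm of a random variable bounded below by `σ > 0` is controlled by
its relative variance. -/
lemma HasRelVarLE.abs_integral_log_sub_log_le {f : α → ℝ} {δ σ : ℝ} (hf : HasRelVarLE f P δ)
    (hσ : 0 < σ) (hσf : ∀ x, σ ≤ f x) :
    |∫ x, Real.log (f x) ∂P - Real.log (∫ x, f x ∂P)| ≤
      (2 + 4 * Real.log ((∫ x, f x ∂P) / σ)) * δ := by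
  have hpos (x : α) : 0 < f x := hσ.trans_le (hσf x)
  have hint := hf.1.integrable_log hσ hσf
  set a := ∫ x, f x ∂P
  have hσa : σ ≤ a := by
    have := integral_mono (integrable_const σ) hf.1.integrable hσf
    simpa using this
  have ha : 0 < a := hσ.trans_le hσa
  set L := Real.log (a / σ)
  have hL : 0 ≤ L := Real.log_nonneg ((one_le_div hσ).2 hσa)
  have hr := (hf.1.const_mul a⁻¹)
  -- The normalized variable `f / a` has mean one, so the linear term of the logarithm integrates to
  -- zero and only the quadratic error is left.
  have hr1 : ∫ x, (a⁻¹ * f x - 1) ∂P = 0 := by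
    rw [integral_sub hr.integrable (integrable_const _), integral_const_mul]
    simp [a, ha.ne']
  have hr2 : ∫ x, (a⁻¹ * f x - 1) ^ 2 ∂P ≤ δ := by
    have e (x : α) : (a⁻¹ * f x - 1) ^ 2 = (a ^ 2)⁻¹ * (f x - a) ^ 2 := by field_simp
    simp only [e]
    rw [integral_const_mul, inv_mul_le_iff₀ (by positivity), mul_comm]
    exact hf.3
  have hlog (x : α) : Real.log (a⁻¹ * f x) = Real.log (f x) - Real.log a := by
    rw [Real.log_mul (by positivity) (hpos x).ne', Real.log_inv]; ring
  have hI : ∫ x, Real.log (a⁻¹ * f x) ∂P = ∫ x, Real.log (f x) ∂P - Real.log a := by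
    simp only [hlog]
    rw [integral_sub hint (integrable_const _)]; simp
  have hIi : Integrable (fun x => Real.log (a⁻¹ * f x)) P := by
    simp only [hlog]; exact hint.sub (integrable_const _)
  rw [← hI, abs_le]
  have hs := (hr.sub (.const 1))
  have hs2 := (hs.pow 2).const_mul (2 + 4 * L)
  have hδ : 0 ≤ (2 + 4 * L) * δ :=
    mul_nonneg (by positivity) ((MeasureTheory.integral_nonneg fun x => sq_nonneg _).trans hr2)
  constructor
  · have h := integral_mono (hs.sub hs2).integrable hIi fun x =>
      log_lower_bound (mul_pos (inv_pos.2 ha) (hpos x)) hL (by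
        rw [← Real.log_inv, inv_div]
        refine Real.log_le_log (by positivity) ?_
        rw [div_eq_inv_mul]
        exact mul_le_mul_of_nonneg_left (hσf x) (by positivity))
    rw [integral_sub hs.integrable hs2.integrable, integral_const_mul, hr1] at h
    nlinarith [mul_le_mul_of_nonneg_left hr2 (show 0 ≤ 2 + 4 * L by positivity)]
  · have h := integral_mono hIi hs.integrable fun x =>
      Real.log_le_sub_one_of_pos (mul_pos (inv_pos.2 ha) (hpos x))
    rw [hr1] at h
    linarith

end RelativeVariance

/-! ### Sums that are independent and centred given a common variable. -/

section SumOfConditionallyCentered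

variable {α ι : Type*} [Fintype ι] {β : ι → Type*} {mα : MeasurableSpace α}
  {mβ : ∀ i, MeasurableSpace (β i)} {P : Measure α} [IsProbabilityMeasure P]
  {ρ : ∀ i, Measure (β i)} [∀ i, IsProbabilityMeasure (ρ i)]

lemma integral_sq_sum_pi {g : ∀ i, β i → ℝ} (hg : ∀ i, FiniteMoments (g i) (ρ i))
    (h0 : ∀ i, ∫ y, g i y ∂(ρ i) = 0) :
    ∫ r : ∀ i, β i, (∑ i, g i (r i)) ^ 2 ∂(Measure.pi ρ) = ∑ i, ∫ y, g i y ^ 2 ∂(ρ i) := by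
  have hF : FiniteMoments (fun r : ∀ i, β i => ∑ i, g i (r i)) (Measure.pi ρ) :=
    .sum fun i _ => (hg i).comp_eval
  have h1 := variance_sum_pi (μ := ρ) fun i => (hg i).memLp_two
  have e : (∑ i, fun r : ∀ i, β i => g i (r i)) = fun r => ∑ i, g i (r i) := by ext; simp
  rw [e, variance_of_integral_eq_zero hF.aestronglyMeasurable.aemeasurable] at h1
  · simpa [variance_of_integral_eq_zero (hg _).aestronglyMeasurable.aemeasurable (h0 _)] using h1
  · rw [integral_finsetSum _ fun i _ => (hg i).comp_eval.integrable]
    exact Finset.sum_eq_zero fun i _ => by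
      rw [integral_comp_eval (hg i).aestronglyMeasurable, h0]

/-- By Fubini, fix the common variable `u`; the summands are then independent and centred, so their
variances add. -/
lemma integral_sq_sum_le {d : ∀ i, α → β i → ℝ} {B : ι → α → ℝ}
    (hd : ∀ i, FiniteMoments (fun p : α × β i => d i p.1 p.2) (P.prod (ρ i)))
    (hdu : ∀ i u, FiniteMoments (d i u) (ρ i)) (h0 : ∀ i u, ∫ y, d i u y ∂(ρ i) = 0)
    (hB : ∀ i u, ∫ y, d i u y ^ 2 ∂(ρ i) ≤ B i u) (hBi : ∀ i, Integrable (B i) P) :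
    ∫ p : α × ∀ i, β i, (∑ i, d i p.1 (p.2 i)) ^ 2 ∂(P.prod (Measure.pi ρ)) ≤
      ∑ i, ∫ u, B i u ∂P := by
  have hF : FiniteMoments (fun p : α × ∀ i, β i => ∑ i, d i p.1 (p.2 i))
      (P.prod (Measure.pi ρ)) :=
    .sum fun i _ => (hd i).comp (g := fun p : α × ∀ i, β i => (p.1, p.2 i))
      ((MeasurePreserving.id P).prod (measurePreserving_eval ρ i))
  rw [integral_prod _ (hF.pow 2).integrable, ← integral_finsetSum _ fun i _ => hBi i]
  refine integral_mono (hF.pow 2).integrable.integral_prod_left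
    (integrable_finsetSum _ fun i _ => hBi i) fun u => ?_
  simp only
  rw [integral_sq_sum_pi (hdu · u) (h0 · u)]
  exact Finset.sum_le_sum fun i _ => hB i u

end SumOfConditionallyCentered

/-! ### Concentration of the channel of one user. -/

section SingleUser

lemma FiniteMoments.dotProduct_star {α ι : Type*} [Fintype ι] {mα : MeasurableSpace α}
    {P : Measure α} [IsFiniteMeasure P] {U W : α → ι → ℂ}
    (hU : ∀ t, FiniteMoments (fun x => U x t) P) (hW : ∀ t, FiniteMoments (fun x => W x t) P) :
    FiniteMoments (fun x => U x ⬝ᵥ star (W x)) P :=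
  .sum fun t _ => (hU t).mul (hW t).conj

lemma FiniteMoments.sqNorm {α : Type*} {N : ℕ} {mα : MeasurableSpace α}
    {P : Measure α} [IsFiniteMeasure P] {U : α → Fin N → ℂ}
    (hU : ∀ t, FiniteMoments (fun x => U x t) P) : FiniteMoments (fun x => sqNorm (U x)) P :=
  .sum fun t _ => (hU t).norm.pow 2

lemma sqNorm_nonneg {N : ℕ} (v : Fin N → ℂ) : 0 ≤ sqNorm v :=
  Finset.sum_nonneg fun _ _ => sq_nonneg _

lemma norm_sum_sq_le {N : ℕ} (v : Fin N → ℂ) : ‖∑ t, v t‖ ^ 2 ≤ N * sqNorm v := by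
  calc ‖∑ t, v t‖ ^ 2 ≤ (∑ t, ‖v t‖) ^ 2 := by gcongr; exact norm_sum_le _ _
    _ ≤ N * sqNorm v := by
      simpa [sqNorm] using sq_sum_le_card_mul_sum_sq (s := Finset.univ) (f := fun t => ‖v t‖)

variable {μ : Measure ℂ} [IsProbabilityMeasure μ] (hμ : FiniteMoments (fun z => z) μ)

include hμ

lemma finiteMoments_entry {ι : Type*} [Fintype ι] (t : ι) :
    FiniteMoments (fun x : ι → ℂ => x t) (Measure.pi fun _ => μ) :=
  FiniteMoments.comp_eval (X := fun _ : ι => ℂ) (μ := fun _ => μ) (f := fun z => z) hμ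

lemma integral_sqNorm (N : ℕ) :
    ∫ x : Fin N → ℂ, sqNorm x ∂(Measure.pi fun _ => μ) = N * ∫ z, ‖z‖ ^ 2 ∂μ := by
  unfold sqNorm
  rw [integral_finsetSum _ fun t _ => ((finiteMoments_entry hμ t).norm.pow 2).integrable]
  have h (t : Fin N) := integral_comp_eval (ι := Fin N) (X := fun _ => ℂ) (μ := fun _ => μ)
    (i := t) (f := fun z : ℂ => ‖z‖ ^ 2) (by fun_prop)
  simp [h]

lemma integral_sqNorm_sub_mean (N : ℕ) :
    ∫ x : Fin N → ℂ, (sqNorm x - N * ∫ z, ‖z‖ ^ 2 ∂μ) ^ 2 ∂(Measure.pi fun _ => μ) =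
        N * ∫ z, (‖z‖ ^ 2 - ∫ y, ‖y‖ ^ 2 ∂μ) ^ 2 ∂μ ∧
    ∫ x : Fin N → ℂ, (sqNorm x - N * ∫ z, ‖z‖ ^ 2 ∂μ) ^ 4 ∂(Measure.pi fun _ => μ) ≤
        3 * (∫ z, (‖z‖ ^ 2 - ∫ y, ‖y‖ ^ 2 ∂μ) ^ 4 ∂μ) * (N : ℝ) ^ 2 := by
  set A := ∫ z, ‖z‖ ^ 2 ∂μ
  -- The centred power is viewed as complex so that the moment bounds for complex independent sums
  -- apply to it.
  let f : ℂ → ℂ := fun z => ((‖z‖ ^ 2 - A : ℝ) : ℂ)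
  have hc : Continuous f := by fun_prop
  have hf : FiniteMoments f μ := ((hμ.norm.pow 2).sub (.const A)).ofReal
  have hi := iIndepFun_pi (ι := Fin N) (Ω := fun _ => ℂ) (μ := fun _ => μ) (𝓧 := fun _ => ℂ)
    (X := fun _ z => f z) fun t => hc.measurable.aemeasurable
  have hF (t : Fin N) := FiniteMoments.comp_eval (ι := Fin N) (X := fun _ => ℂ) (μ := fun _ => μ)
    (i := t) (f := f) hf
  have hm (t : Fin N) : Measurable fun x : Fin N → ℂ => f (x t) :=
    hc.measurable.comp (measurable_pi_apply t)
  have h0 (t : Fin N) : ∫ x : Fin N → ℂ, f (x t) ∂(Measure.pi fun _ => μ) = 0 := by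
    rw [integral_comp_eval (ι := Fin N) (X := fun _ => ℂ) (μ := fun _ => μ) (i := t) (f := f)
      hc.aestronglyMeasurable, integral_complex_ofReal,
      integral_sub (hμ.norm.pow 2).integrable (integrable_const _)]
    simp [A]
  have hN (t : Fin N) (p : ℕ) (hp : Even p) :
      ∫ x : Fin N → ℂ, ‖f (x t)‖ ^ p ∂(Measure.pi fun _ => μ) = ∫ z, (‖z‖ ^ 2 - A) ^ p ∂μ := by
    rw [integral_comp_eval (ι := Fin N) (X := fun _ => ℂ) (μ := fun _ => μ) (i := t)
      (f := fun z => ‖f z‖ ^ p) (by fun_prop)]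
    refine integral_congr_ae (.of_forall fun z => ?_)
    simp only [f, Complex.norm_real, Real.norm_eq_abs, hp.pow_abs]
  have hs (x : Fin N → ℂ) (p : ℕ) (hp : Even p) :
      ‖∑ t, f (x t)‖ ^ p = (sqNorm x - N * A) ^ p := by
    simp only [f]
    rw [← Complex.ofReal_sum, Complex.norm_real, Real.norm_eq_abs, hp.pow_abs,
      Finset.sum_sub_distrib]
    simp [sqNorm]
  have r2 := integral_norm_sum_sq hm hF hi h0 Finset.univ
  have r4 := integral_norm_sum_four_le (w := fun _ => 1) hm hF hi h0 (fun _ => zero_le_one)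
    (κ := ∫ z, (‖z‖ ^ 2 - A) ^ 4 ∂μ) (fun t => by rw [hN t 4 (by decide)]; simp)
    (integral_nonneg fun z => Even.pow_nonneg (by decide) _) Finset.univ
  simp only [hs _ 2 even_two, hN _ 2 even_two] at r2
  simp only [hs _ 4 (by decide)] at r4
  exact ⟨by simpa using r2, by simpa using r4⟩

lemma integral_sq_norm_sq_sub_mean :
    ∫ z, (‖z‖ ^ 2 - ∫ y, ‖y‖ ^ 2 ∂μ) ^ 2 ∂μ = ∫ z, ‖z‖ ^ 4 ∂μ - (∫ z, ‖z‖ ^ 2 ∂μ) ^ 2 := by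
  have f := hμ.norm.pow 2
  rw [← variance_eq_integral f.aestronglyMeasurable.aemeasurable, variance_eq_sub f.memLp_two]
  simp [← pow_mul]

lemma integral_sqNorm_sq (N : ℕ) :
    ∫ x : Fin N → ℂ, sqNorm x ^ 2 ∂(Measure.pi fun _ => μ) =
      N * (∫ z, ‖z‖ ^ 4 ∂μ - (∫ z, ‖z‖ ^ 2 ∂μ) ^ 2) + (N : ℝ) ^ 2 * (∫ z, ‖z‖ ^ 2 ∂μ) ^ 2 := by
  have hQ := FiniteMoments.sqNorm (N := N) (finiteMoments_entry hμ)
  have h1 := variance_eq_sub hQ.memLp_two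
  rw [variance_eq_integral hQ.aestronglyMeasurable.aemeasurable, integral_sqNorm hμ,
    (integral_sqNorm_sub_mean hμ N).1, integral_sq_norm_sq_sub_mean hμ] at h1
  simp only [Pi.pow_apply] at h1
  linarith

/-- The sum of the entries is, up to conjugation, the matched filter for the all-ones vector. -/
lemma integral_norm_sum_entries_sq (N : ℕ) :
    ∫ x : Fin N → ℂ, ‖∑ t, x t‖ ^ 2 ∂(Measure.pi fun _ => μ) =
      N * ∫ z, ‖z‖ ^ 2 ∂μ + N * (N - 1) * ‖∫ z, z ∂μ‖ ^ 2 := by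
  have h := integral_norm_dotProduct_sq hμ rfl (fun _ : Fin N => 1)
  have e (x : Fin N → ℂ) : ‖(fun _ : Fin N => (1 : ℂ)) ⬝ᵥ star x‖ = ‖∑ t, x t‖ := by
    rw [← norm_star (∑ t, x t), star_sum]; simp [dotProduct]
  simp only [e] at h
  rw [h]
  simp
  ring

/-- Each quantity has variance of lower order by a factor `N` than its squared mean: `N` against
`N²` for `‖x‖²`, and `N³` against `N⁴` for the other two. A nonzero mean is essential for the last
one, since otherwise `|∑ x_t|²` does not concentrate. -/
lemma exists_hasRelVarLE (h0 : ∫ z, z ∂μ ≠ 0) (hA : 0 < ∫ z, ‖z‖ ^ 2 ∂μ) :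
    ∃ κ : ℝ, 0 ≤ κ ∧ ∀ N : ℕ, 1 ≤ N →
      HasRelVarLE (fun x : Fin N → ℂ => sqNorm x) (Measure.pi fun _ => μ) (κ / N) ∧
      HasRelVarLE (fun x : Fin N → ℂ => sqNorm x ^ 2) (Measure.pi fun _ => μ) (κ / N) ∧
      HasRelVarLE (fun x : Fin N → ℂ => ‖∑ t, x t‖ ^ 2) (Measure.pi fun _ => μ) (κ / N) := by
  set A := ∫ z, ‖z‖ ^ 2 ∂μ
  set c := ∫ z, z ∂μ with hc
  have hc0 : 0 < ‖c‖ := norm_pos_iff.2 h0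
  set κ2 := ∫ z, (‖z‖ ^ 2 - A) ^ 2 ∂μ
  set κ4 := ∫ z, (‖z‖ ^ 2 - A) ^ 4 ∂μ
  set m4 := ∫ z, ‖z - c‖ ^ 4 ∂μ
  have hκ2 : 0 ≤ κ2 := by positivity
  have hκ4 : 0 ≤ κ4 := integral_nonneg fun z => Even.pow_nonneg (by decide) _
  have hm4 : 0 ≤ m4 := by positivity
  have hV : 0 ≤ A - ‖c‖ ^ 2 := by
    rw [← integral_norm_sub_mean_sq hμ rfl]; positivity
  set a1 := κ2 / A ^ 2
  set a2 := (6 * κ4 + 8 * A ^ 2 * κ2) / A ^ 4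
  set a3 := (8 * ‖c‖ ^ 2 * (A - ‖c‖ ^ 2) + 6 * m4) / ‖c‖ ^ 4
  have ha1 : 0 ≤ a1 := by positivity
  have ha2 : 0 ≤ a2 := by positivity
  have ha3 : 0 ≤ a3 := by positivity
  refine ⟨a1 + a2 + a3, by positivity, fun N hN => ?_⟩
  have hN0 : (0 : ℝ) < N := by exact_mod_cast hN
  have hN1 : (1 : ℝ) ≤ N := by exact_mod_cast hN
  have hx := finiteMoments_entry hμ (ι := Fin N)
  have hQ := FiniteMoments.sqNorm (N := N) hx
  obtain ⟨q2, q4⟩ := integral_sqNorm_sub_mean hμ N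
  refine ⟨HasRelVarLE.mono (δ := a1 / N) ?_ (by gcongr; linarith),
    HasRelVarLE.mono (δ := a2 / N) ?_ (by gcongr; linarith),
    HasRelVarLE.mono (δ := a3 / N) ?_ (by gcongr; linarith)⟩
  · refine .of_integral_sq_sub_le hQ (a := N * A) (b := N * A) (by positivity) (by positivity)
      (integral_sqNorm hμ N).ge (q2.trans_le (le_of_eq ?_))
    simp only [a1]
    field_simp
    rfl
  · refine .of_integral_sq_sub_le (hQ.pow 2) (a := (N * A) ^ 2) (b := (N * A) ^ 2) (by positivity)
      (by positivity) ?_ ?_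
    · rw [← integral_sqNorm hμ N]
      exact sq_integral_le_integral_sq hQ
    · have g1 := ((hQ.sub (.const (N * A))).pow 4).const_mul 2
      have g2 := ((hQ.sub (.const (N * A))).pow 2).const_mul (8 * (N * A) ^ 2)
      calc ∫ x : Fin N → ℂ, (sqNorm x ^ 2 - (N * A) ^ 2) ^ 2 ∂(Measure.pi fun _ => μ)
          ≤ ∫ x : Fin N → ℂ, 2 * (sqNorm x - N * A) ^ 4 + 8 * (N * A) ^ 2 * (sqNorm x - N * A) ^ 2
              ∂(Measure.pi fun _ => μ) := by
            refine integral_mono (((hQ.pow 2).sub (.const _)).pow 2).integrable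
              (g1.add g2).integrable fun x => ?_
            -- With `D = ‖x‖² - N A`, the bound is `D² (D + 2NA)² ≤ 2D⁴ + 8 (NA)² D²`.
            have e : (sqNorm x ^ 2 - (N * A) ^ 2) ^ 2 =
                (sqNorm x - N * A) ^ 2 * ((sqNorm x - N * A) + 2 * (N * A)) ^ 2 := by ring
            rw [e]
            nlinarith [mul_nonneg (sq_nonneg (sqNorm x - N * A))
              (sq_nonneg ((sqNorm x - N * A) - 2 * (N * A)))]
        _ ≤ 2 * (3 * κ4 * N ^ 2) + 8 * (N * A) ^ 2 * (N * κ2) := by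
            rw [integral_add g1.integrable g2.integrable, integral_const_mul, integral_const_mul,
              q2]
            gcongr
        _ ≤ (6 * κ4 + 8 * A ^ 2 * κ2) * (N : ℝ) ^ 3 := by
            nlinarith [mul_nonneg (mul_nonneg hκ4 (sq_nonneg (N : ℝ))) (sub_nonneg.2 hN1)]
        _ = a2 / N * ((N * A) ^ 2) ^ 2 := by
            simp only [a2]
            field_simp
  · have hs : FiniteMoments (fun x : Fin N → ℂ => ‖∑ t, x t‖ ^ 2) (Measure.pi fun _ => μ) :=
      (FiniteMoments.sum fun t _ => hx t).norm.pow 2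
    have h := integral_sq_norm_dotProduct_sq_sub_le hμ rfl (fun _ : Fin N => 1)
    have e (x : Fin N → ℂ) : ‖(fun _ : Fin N => (1 : ℂ)) ⬝ᵥ star x‖ = ‖∑ t, x t‖ := by
      rw [← norm_star (∑ t, x t), star_sum]; simp [dotProduct]
    simp only [e] at h
    refine .of_integral_sq_sub_le hs (b := N * N * ‖c‖ ^ 2) (by positivity) (by positivity) ?_
      (h.trans ?_)
    · rw [integral_norm_sum_entries_sq hμ]
      change N * N * ‖c‖ ^ 2 ≤ N * A + N * (N - 1) * ‖c‖ ^ 2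
      nlinarith [mul_nonneg hN0.le hV]
    · change 8 * (‖∑ _t : Fin N, (1 : ℂ)‖ ^ 2 * ‖c‖ ^ 2) * ((∑ _t : Fin N, ‖(1 : ℂ)‖ ^ 2) *
        (A - ‖c‖ ^ 2)) + 6 * m4 * (∑ _t : Fin N, ‖(1 : ℂ)‖ ^ 2) ^ 2 ≤ _
      have e2 : a3 / N * (N * N * ‖c‖ ^ 2) ^ 2 =
          (8 * ‖c‖ ^ 2 * (A - ‖c‖ ^ 2) + 6 * m4) * (N : ℝ) ^ 3 := by
        simp only [a3]
        field_simp
      rw [e2]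
      simp
      nlinarith [mul_nonneg (mul_nonneg hm4 (sq_nonneg (N : ℝ))) (sub_nonneg.2 hN1)]

end SingleUser

/-! ### Transmit power and the SINR in closed form. -/

namespace LMSSystem

variable {S : LMSSystem}

/-- The law of a channel entry of user `k`. -/
noncomputable abbrev entryLaw (S : LMSSystem) (k : ℕ) : Measure ℂ :=
  shadowedRician (S.m k) (S.Ω k) (S.b k)

lemma precoder_some {N K : ℕ} (hHat : Fin K → Fin N → ℂ) (t : Fin N) (i : Fin K) :
    precoder hHat t (some i) = star (hHat i t) := rfl

lemma precoder_none {N K : ℕ} (hHat : Fin K → Fin N → ℂ) (t : Fin N) :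
    precoder hHat t none = ∑ i, star (hHat i t) := rfl

lemma transmitPower_eq (hρ : S.ρ ∈ Set.Icc (0 : ℝ) 1) {N K : ℕ} (g : Fin K → Fin N → ℂ) :
    (Matrix.trace ((precoder g)ᴴ * precoder g * S.splitting K ^ 2)).re =
      S.ρ * sqNorm (fun t => ∑ i, g i t) + (1 - S.ρ) * ∑ i, sqNorm (g i) := by
  have h (c : Option (Fin K)) : ((precoder g)ᴴ * precoder g) c c =
      ((∑ t, ‖precoder g t c‖ ^ 2 : ℝ) : ℂ) := by
    simp [Matrix.mul_apply, Matrix.conjTranspose_apply, ← Complex.normSq_eq_conj_mul_self,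
      Complex.normSq_eq_norm_sq]
  have h1 : 0 ≤ 1 - S.ρ := by linarith [hρ.2]
  have e1 : ((Real.sqrt S.ρ : ℂ)) ^ 2 = (S.ρ : ℂ) := by
    rw [← Complex.ofReal_pow, Real.sq_sqrt hρ.1]
  have e2 : ((Real.sqrt (1 - S.ρ) : ℂ)) ^ 2 = ((1 - S.ρ : ℝ) : ℂ) := by
    rw [← Complex.ofReal_pow, Real.sq_sqrt h1]
  rw [splitting, Matrix.diagonal_pow, Matrix.trace]
  simp only [Matrix.diag_apply, Matrix.mul_diagonal, h, Fintype.sum_option, Pi.pow_apply, e1, e2,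
    precoder_none, precoder_some, ← star_sum, norm_star, ← Complex.ofReal_mul,
    ← Complex.ofReal_sum, ← Complex.ofReal_add, Complex.ofReal_re, sqNorm, Finset.mul_sum,
    Finset.sum_mul]
  simp only [mul_comm]

lemma transmitPower_nonneg (hρ : S.ρ ∈ Set.Icc (0 : ℝ) 1) {N K : ℕ} (g : Fin K → Fin N → ℂ) :
    0 ≤ (Matrix.trace ((precoder g)ᴴ * precoder g * S.splitting K ^ 2)).re := by
  rw [transmitPower_eq hρ]
  have h1 : 0 ≤ 1 - S.ρ := by linarith [hρ.2]
  exact add_nonneg (mul_nonneg hρ.1 (sqNorm_nonneg _))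
    (mul_nonneg h1 (Finset.sum_nonneg fun i _ => sqNorm_nonneg _))

lemma alpha_mul_nonneg (hpower : 0 < S.power) (hρ : S.ρ ∈ Set.Icc (0 : ℝ) 1) (N K : ℕ) :
    0 ≤ S.alpha N K * (1 - S.ρ) :=
  mul_nonneg (div_nonneg hpower.le (integral_nonneg fun p => transmitPower_nonneg hρ _))
    (by linarith [hρ.2])

/-- The error is centred and white, so averaging over it removes the cross term and adds `σ_{e_i}²
‖h_k‖²`. -/
lemma privatePower_eq (hpower : 0 < S.power) (hρ : S.ρ ∈ Set.Icc (0 : ℝ) 1) (N K : ℕ)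
    (h : Fin K → Fin N → ℂ) (k i : Fin K) :
    S.privatePower N K h k i = S.alpha N K * (1 - S.ρ) *
      (‖h k ⬝ᵥ star (h i)‖ ^ 2 + sqNorm (h k) * S.errVar i) := by
  have hβ := alpha_mul_nonneg hpower hρ N K
  have e (g : Fin K → Fin N → ℂ) : ‖(Real.sqrt (S.alpha N K * (1 - S.ρ)) : ℂ) *
      (h k ⬝ᵥ fun t => precoder (h + g) t (some i))‖ ^ 2 =
      S.alpha N K * (1 - S.ρ) * ‖h k ⬝ᵥ star (h i) + h k ⬝ᵥ star (g i)‖ ^ 2 := by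
    rw [norm_mul, mul_pow, Complex.norm_real, Real.norm_eq_abs, sq_abs, Real.sq_sqrt hβ,
      ← dotProduct_add, ← star_add]
    rfl
  have hI := integral_comp_eval (ι := Fin K) (X := fun _ => Fin N → ℂ)
    (μ := fun k => Measure.pi fun _ => complexNormal (S.errVar k)) (i := i)
    (f := fun y => ‖h k ⬝ᵥ star (h i) + h k ⬝ᵥ star y‖ ^ 2)
    (by refine Continuous.aestronglyMeasurable ?_
        simp only [dotProduct, Pi.star_apply]
        fun_prop)
  simp only [privatePower, errorLaw, e]
  rw [integral_const_mul, hI, integral_norm_add_dotProduct_sq (complexNormal_finiteMoments _)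
    (complexNormal_integral_id _), complexNormal_integral_norm_sq]
  simp [sqNorm]

lemma dotProduct_star_self_norm {N : ℕ} (v : Fin N → ℂ) : ‖v ⬝ᵥ star v‖ = sqNorm v := by
  have : v ⬝ᵥ star v = ((sqNorm v : ℝ) : ℂ) := by
    simp [dotProduct, sqNorm, Complex.mul_conj, Complex.normSq_eq_norm_sq]
  rw [this, Complex.norm_real, Real.norm_of_nonneg (sqNorm_nonneg v)]

lemma sinr_eq (hpower : 0 < S.power) (hρ : S.ρ ∈ Set.Icc (0 : ℝ) 1) (N K : ℕ) (k : Fin K)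
    (h : Fin K → Fin N → ℂ) : S.sinr N K k h =
        (S.alpha N K * (1 - S.ρ) * sqNorm (h k) ^ 2
            + S.alpha N K * (1 - S.ρ) * sqNorm (h k) * S.errVar k) /
          (S.noiseVar k + S.alpha N K * (1 - S.ρ) *
            ∑ i ∈ Finset.univ.erase k,
              (‖h k ⬝ᵥ star (h i)‖ ^ 2 + sqNorm (h k) * S.errVar i)) := by
  simp only [sinr, privatePower_eq hpower hρ, ← Finset.mul_sum, dotProduct_star_self_norm]
  ring_nf

/-! ### Moments of the channels and the power normalization. -/

section Moments

variable (hm : ∀ i, 0 < S.m i) (hΩ : ∀ i, 0 < S.Ω i)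

include hm hΩ

lemma isProbabilityMeasure_entryLaw (k : ℕ) : IsProbabilityMeasure (S.entryLaw k) :=
  isProbabilityMeasure_shadowedRician (hm k) (hΩ k) _

lemma entryLaw_finiteMoments (k : ℕ) : FiniteMoments (fun z => z) (S.entryLaw k) :=
  shadowedRician_finiteMoments (hm k) (hΩ k) _

lemma integral_entryLaw (k : ℕ) : ∫ z, z ∂(S.entryLaw k) = (S.meanC k : ℂ) :=
  shadowedRician_integral_id (hm k) (hΩ k) _

lemma momentA_eq (k : ℕ) : S.momentA k = 2 * S.b k + S.Ω k :=
  shadowedRician_integral_norm_sq (hm k) (hΩ k) _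

lemma momentA_pos (k : ℕ) : 0 < S.momentA k := by
  rw [momentA_eq hm hΩ]
  have := hΩ k
  positivity

lemma meanC_pos (k : ℕ) : 0 < S.meanC k := by
  have h1 := Real.Gamma_pos_of_pos (hm k)
  have h2 := Real.Gamma_pos_of_pos (show 0 < S.m k + 1 / 2 by linarith [hm k])
  have h3 := Real.sqrt_pos.2 (div_pos (hΩ k) (hm k))
  unfold meanC
  positivity

lemma norm_meanC (k : ℕ) : ‖(S.meanC k : ℂ)‖ = S.meanC k := by
  rw [Complex.norm_real, Real.norm_of_nonneg (meanC_pos hm hΩ k).le]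

lemma meanC_sq_le_momentA (k : ℕ) : S.meanC k ^ 2 ≤ S.momentA k := by
  have := isProbabilityMeasure_entryLaw hm hΩ k
  have h := integral_norm_sub_mean_sq (entryLaw_finiteMoments hm hΩ k)
    (integral_entryLaw hm hΩ k)
  rw [norm_meanC hm hΩ] at h
  have h2 : 0 ≤ ∫ z, ‖z - (S.meanC k : ℂ)‖ ^ 2 ∂(S.entryLaw k) := by positivity
  rw [h] at h2
  exact sub_nonneg.1 h2

lemma integral_entryLaw_norm_four (k : ℕ) : ∫ z, ‖z‖ ^ 4 ∂(S.entryLaw k) =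
    4 * (S.b k : ℝ) ^ 2 + 4 * S.b k * S.Ω k + S.Ω k ^ 2 / S.m k + S.momentA k ^ 2 := by
  rw [momentA_eq hm hΩ, shadowedRician_integral_norm_four (hm k) (hΩ k)]
  ring

/-- Uniform kurtosis: `E|z|⁴ ≤ (2 + 1/m₀) A²` because `Ω²/m ≤ A²/m₀`, and centring costs only a
constant. The lower bound on the shapes enters the final constant here. -/
lemma integral_entryLaw_norm_sub_four_le {m₀ : ℝ} (hm₀ : 0 < m₀) (hmm : ∀ i, m₀ ≤ S.m i) (k : ℕ) :
    ∫ z, ‖z - (S.meanC k : ℂ)‖ ^ 4 ∂(S.entryLaw k) ≤ 16 * (2 + 1 / m₀) * S.momentA k ^ 2 := by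
  have := isProbabilityMeasure_entryLaw hm hΩ k
  have hF := entryLaw_finiteMoments hm hΩ k
  have f1 := (hF.norm.pow 4).const_mul 8
  have h1 : ∫ z, ‖z - (S.meanC k : ℂ)‖ ^ 4 ∂(S.entryLaw k) ≤
      ∫ z, 8 * ‖z‖ ^ 4 + 8 * S.meanC k ^ 4 ∂(S.entryLaw k) := by
    refine integral_mono ((hF.sub (.const _)).norm.pow 4).integrable
      (f1.add (.const _)).integrable fun z => ?_
    have h := norm_sub_le z (S.meanC k : ℂ)
    rw [norm_meanC hm hΩ] at h
    calc ‖z - (S.meanC k : ℂ)‖ ^ 4 ≤ (‖z‖ + S.meanC k) ^ 4 := by gcongr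
      _ ≤ 8 * ‖z‖ ^ 4 + 8 * S.meanC k ^ 4 := by
        nlinarith [sq_nonneg (‖z‖ ^ 2 - S.meanC k ^ 2), sq_nonneg ((‖z‖ - S.meanC k) ^ 2),
          sq_nonneg (‖z‖ - S.meanC k), sq_nonneg ((‖z‖ - S.meanC k) * (‖z‖ + S.meanC k)),
          sq_nonneg (‖z‖ * (‖z‖ - S.meanC k)), sq_nonneg (S.meanC k * (‖z‖ - S.meanC k)),
          mul_nonneg (sq_nonneg (‖z‖ - S.meanC k)) (sq_nonneg (‖z‖ + S.meanC k))]
  rw [integral_add f1.integrable (integrable_const _), integral_const_mul,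
    integral_entryLaw_norm_four hm hΩ] at h1
  simp only [integral_const, probReal_univ, one_smul] at h1
  have h2 : S.meanC k ^ 4 ≤ S.momentA k ^ 2 := by
    rw [show 4 = 2 * 2 by rfl, pow_mul]
    have := meanC_sq_le_momentA hm hΩ k
    gcongr
  have hA := momentA_eq hm hΩ k
  have hb : (0 : ℝ) ≤ S.b k := (S.b k).2
  have h3 : S.Ω k ^ 2 / S.m k ≤ 1 / m₀ * S.momentA k ^ 2 := by
    rw [div_eq_mul_one_div, mul_comm]
    have h4 := one_div_le_one_div_of_le hm₀ (hmm k)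
    have h5 := hm k
    have h6 := hΩ k
    gcongr
    rw [hA]; linarith
  have h7 : 4 * (S.b k : ℝ) ^ 2 + 4 * S.b k * S.Ω k ≤ S.momentA k ^ 2 := by
    rw [hA]; nlinarith [sq_nonneg (S.Ω k)]
  have h8 : 0 ≤ 1 / m₀ * S.momentA k ^ 2 := by positivity
  nlinarith

lemma isProbabilityMeasure_userLaw (N k : ℕ) :
    IsProbabilityMeasure (Measure.pi fun _ : Fin N => S.entryLaw k) :=
  have := isProbabilityMeasure_entryLaw hm hΩ k
  inferInstance

lemma isProbabilityMeasure_channelLaw (N K : ℕ) : IsProbabilityMeasure (S.channelLaw N K) :=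
  have := isProbabilityMeasure_userLaw hm hΩ N
  inferInstanceAs (IsProbabilityMeasure
    (Measure.pi fun k : Fin K => Measure.pi fun _ : Fin N => S.entryLaw k))

lemma measurePreserving_user (N K : ℕ) (k : Fin K) :
    MeasurePreserving (fun h : Fin K → Fin N → ℂ => h k) (S.channelLaw N K)
      (Measure.pi fun _ : Fin N => S.entryLaw k) :=
  have := isProbabilityMeasure_userLaw hm hΩ N
  measurePreserving_eval (fun k : Fin K => Measure.pi fun _ : Fin N => S.entryLaw k) k

lemma measurePreserving_entry (N K : ℕ) (k : Fin K) (t : Fin N) :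
    MeasurePreserving (fun h : Fin K → Fin N → ℂ => h k t) (S.channelLaw N K) (S.entryLaw k) :=
  have := isProbabilityMeasure_entryLaw hm hΩ k
  (measurePreserving_eval (fun _ : Fin N => S.entryLaw k) t).comp
    (measurePreserving_user hm hΩ N K k)

lemma channel_finiteMoments (N K : ℕ) (k : Fin K) (t : Fin N) :
    FiniteMoments (fun h : Fin K → Fin N → ℂ => h k t) (S.channelLaw N K) :=
  (entryLaw_finiteMoments hm hΩ k).comp (measurePreserving_entry hm hΩ N K k t)

lemma momentD_eq (N K : ℕ) (k : Fin K) : S.momentD N K k =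
    N * (4 * (S.b k : ℝ) ^ 2 + 4 * S.b k * S.Ω k + S.Ω k ^ 2 / S.m k)
      + (N : ℝ) ^ 2 * S.momentA k ^ 2 := by
  have := isProbabilityMeasure_entryLaw hm hΩ k
  have hF := entryLaw_finiteMoments hm hΩ k
  have hQ := FiniteMoments.sqNorm (N := N) (finiteMoments_entry hF)
  rw [momentD, (measurePreserving_user hm hΩ N K k).integral_comp_of_aestronglyMeasurable
    (f := fun x => sqNorm x ^ 2) (hQ.pow 2).aestronglyMeasurable, integral_sqNorm_sq hF,
    integral_entryLaw_norm_four hm hΩ]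
  change N * (_ + S.momentA k ^ 2 - S.momentA k ^ 2) + (N : ℝ) ^ 2 * S.momentA k ^ 2 = _
  ring

lemma integral_sqNorm_channel (N K : ℕ) (k : Fin K) :
    ∫ h, sqNorm (h k) ∂(S.channelLaw N K) = N * S.momentA k := by
  have := isProbabilityMeasure_entryLaw hm hΩ k
  have hF := entryLaw_finiteMoments hm hΩ k
  rw [(measurePreserving_user hm hΩ N K k).integral_comp_of_aestronglyMeasurable
    (f := fun x => sqNorm x)
    (FiniteMoments.sqNorm (N := N) (finiteMoments_entry hF)).aestronglyMeasurable,
    integral_sqNorm hF]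
  rfl

lemma measurePreserving_pair (N K : ℕ) {k i : Fin K} (hki : k ≠ i) :
    MeasurePreserving (fun h : Fin K → Fin N → ℂ => (h k, h i)) (S.channelLaw N K)
      ((Measure.pi fun _ : Fin N => S.entryLaw k).prod
        (Measure.pi fun _ : Fin N => S.entryLaw i)) := by
  have := isProbabilityMeasure_userLaw hm hΩ N
  have := isProbabilityMeasure_channelLaw hm hΩ N K
  have hi := iIndepFun_pi (ι := Fin K) (Ω := fun _ => Fin N → ℂ)
    (μ := fun k => Measure.pi fun _ => S.entryLaw k) (𝓧 := fun _ => Fin N → ℂ)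
    (X := fun _ x => x) fun t => aemeasurable_id
  have h := hi.indepFun hki
  have hk := measurePreserving_user hm hΩ N K k
  have hi := measurePreserving_user hm hΩ N K i
  refine ⟨hk.measurable.prodMk hi.measurable, ?_⟩
  rw [← hk.map_eq, ← hi.map_eq]
  exact (indepFun_iff_map_prod_eq_prod_map_map hk.aemeasurable hi.aemeasurable).1 h

/-- Integrating out user `i` first leaves the conditional mean, a combination of `|∑ h_k(t)|²` and
`‖h_k‖²`. -/
lemma momentE_eq (N K : ℕ) {k i : Fin K} (hik : i ≠ k) : S.momentE N K k i =
    N * S.momentA k * S.momentA i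
      + (N : ℝ) * ((N : ℝ) - 1) * S.meanC k ^ 2 * S.meanC i ^ 2 := by
  have := isProbabilityMeasure_entryLaw hm hΩ
  have hF := entryLaw_finiteMoments hm hΩ
  have hx (j : ℕ) := finiteMoments_entry (hF j) (ι := Fin N)
  have hX : FiniteMoments (fun p : (Fin N → ℂ) × (Fin N → ℂ) => ‖p.1 ⬝ᵥ star p.2‖ ^ 2)
      ((Measure.pi fun _ : Fin N => S.entryLaw k).prod
        (Measure.pi fun _ : Fin N => S.entryLaw i)) :=
    (FiniteMoments.dotProduct_star (fun t => (hx k t).comp_fst _)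
      (fun t => (hx i t).comp_snd _)).norm.pow 2
  rw [momentE, (measurePreserving_pair hm hΩ N K hik.symm).integral_comp_of_aestronglyMeasurable
    (f := fun p => ‖p.1 ⬝ᵥ star p.2‖ ^ 2) hX.aestronglyMeasurable, integral_prod _ hX.integrable]
  simp only [integral_norm_dotProduct_sq (hF i) (integral_entryLaw hm hΩ i)]
  have hs : FiniteMoments (fun x : Fin N → ℂ => ‖∑ t, x t‖ ^ 2)
      (Measure.pi fun _ => S.entryLaw k) := (FiniteMoments.sum fun t _ => hx k t).norm.pow 2
  have hQ := FiniteMoments.sqNorm (N := N) (hx k)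
  have h1 := integral_sqNorm (hF k) N
  have h2 := integral_norm_sum_entries_sq (hF k) N
  unfold sqNorm at hQ h1
  rw [integral_add (hs.mul (.const _)).integrable (hQ.mul (.const _)).integrable,
    integral_mul_const, integral_mul_const, h1, h2, integral_entryLaw hm hΩ, norm_meanC hm hΩ,
    norm_meanC hm hΩ]
  change (N * S.momentA k + N * (N - 1) * S.meanC k ^ 2) * S.meanC i ^ 2
    + N * S.momentA k * (S.momentA i - S.meanC i ^ 2) = _
  ring

lemma integral_norm_estimate_sq (N K : ℕ) (i : Fin K) (t : Fin N) :
    FiniteMoments (fun p : (Fin K → Fin N → ℂ) × (Fin K → Fin N → ℂ) => p.1 i t + p.2 i t)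
      ((S.channelLaw N K).prod (S.errorLaw N K)) ∧
    ∫ p : (Fin K → Fin N → ℂ) × (Fin K → Fin N → ℂ), ‖p.1 i t + p.2 i t‖ ^ 2
      ∂((S.channelLaw N K).prod (S.errorLaw N K)) = S.momentA i + S.errVar i := by
  have := isProbabilityMeasure_channelLaw hm hΩ N K
  have : IsProbabilityMeasure (S.errorLaw N K) := by unfold errorLaw; infer_instance
  have hp : MeasurePreserving (fun e : Fin K → Fin N → ℂ => e i t) (S.errorLaw N K)
      (complexNormal (S.errVar i)) :=
    (measurePreserving_eval (fun _ : Fin N => complexNormal (S.errVar i)) t).comp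
      (measurePreserving_eval
        (fun k : Fin K => Measure.pi fun _ : Fin N => complexNormal (S.errVar k)) i)
  have hq := measurePreserving_entry hm hΩ N K i t
  have hh := (channel_finiteMoments hm hΩ N K i t).comp_fst (S.errorLaw N K)
  have he := ((complexNormal_finiteMoments (S.errVar i)).comp hp).comp_snd (S.channelLaw N K)
  refine ⟨hh.add he, ?_⟩
  have hi := indepFun_prod (μ := S.channelLaw N K) (ν := S.errorLaw N K)
    (X := fun h => h i t) (Y := fun e => e i t) (by fun_prop) (by fun_prop)
  have h0 : ∫ p : (Fin K → Fin N → ℂ) × (Fin K → Fin N → ℂ), p.2 i t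
      ∂((S.channelLaw N K).prod (S.errorLaw N K)) = 0 := by
    rw [integral_fun_snd (fun e : Fin K → Fin N → ℂ => e i t),
      hp.integral_comp_of_aestronglyMeasurable (f := fun z => z) aestronglyMeasurable_id,
      complexNormal_integral_id, smul_zero]
  have h := hi.symm.integral_norm_add_sq he hh h0
  simp only [add_comm (_ : ℂ)] at h ⊢
  rw [h, integral_fun_snd (fun e : Fin K → Fin N → ℂ => ‖e i t‖ ^ 2),
    integral_fun_fst (fun e : Fin K → Fin N → ℂ => ‖e i t‖ ^ 2),
    hp.integral_comp_of_aestronglyMeasurable (f := fun z => ‖z‖ ^ 2) (by fun_prop),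
    hq.integral_comp_of_aestronglyMeasurable (f := fun z => ‖z‖ ^ 2) (by fun_prop),
    complexNormal_integral_norm_sq]
  simp [momentA, add_comm]

/-- The private streams use at most the total power; the power of the common stream is nonnegative
and is dropped. -/
lemma alpha_mul_le (hpower : 0 < S.power) (hρ : S.ρ ∈ Set.Icc (0 : ℝ) 1) (N K : ℕ) :
    S.alpha N K * (1 - S.ρ) * (N * ∑ i : Fin K, (S.momentA i + S.errVar i)) ≤ S.power := by
  have := isProbabilityMeasure_channelLaw hm hΩ N K
  have : IsProbabilityMeasure (S.errorLaw N K) := by unfold errorLaw; infer_instance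
  have hG (i : Fin K) (t : Fin N) := integral_norm_estimate_sq hm hΩ N K i t
  have h1 : 0 ≤ 1 - S.ρ := by linarith [hρ.2]
  set I := ∫ p : (Fin K → Fin N → ℂ) × (Fin K → Fin N → ℂ),
    (Matrix.trace ((precoder (p.1 + p.2))ᴴ * precoder (p.1 + p.2) * S.splitting K ^ 2)).re
      ∂((S.channelLaw N K).prod (S.errorLaw N K)) with hI
  have hf1 : FiniteMoments (fun p : (Fin K → Fin N → ℂ) × (Fin K → Fin N → ℂ) =>
      S.ρ * sqNorm (fun t => ∑ i, (p.1 i t + p.2 i t)))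
      ((S.channelLaw N K).prod (S.errorLaw N K)) :=
    (FiniteMoments.sqNorm fun t => .sum fun i _ => (hG i t).1).const_mul _
  have hf2 : FiniteMoments (fun p : (Fin K → Fin N → ℂ) × (Fin K → Fin N → ℂ) =>
      (1 - S.ρ) * ∑ i, sqNorm (fun t => p.1 i t + p.2 i t))
      ((S.channelLaw N K).prod (S.errorLaw N K)) :=
    (FiniteMoments.sum fun i _ => .sqNorm fun t => (hG i t).1).const_mul _
  have hle : (1 - S.ρ) * (N * ∑ i : Fin K, (S.momentA i + S.errVar i)) ≤ I := by
    have e : ∫ p : (Fin K → Fin N → ℂ) × (Fin K → Fin N → ℂ),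
        (1 - S.ρ) * ∑ i, sqNorm (fun t => p.1 i t + p.2 i t)
        ∂((S.channelLaw N K).prod (S.errorLaw N K)) =
        (1 - S.ρ) * (N * ∑ i : Fin K, (S.momentA i + S.errVar i)) := by
      rw [integral_const_mul, integral_finsetSum _ fun i _ =>
        (FiniteMoments.sqNorm fun t => (hG i t).1).integrable]
      congr 1
      rw [Finset.mul_sum]
      refine Finset.sum_congr rfl fun i _ => ?_
      unfold sqNorm
      rw [integral_finsetSum _ fun t _ => ((hG i t).1.norm.pow 2).integrable]
      simp [(hG i _).2, mul_add]
    rw [← e, hI]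
    simp only [transmitPower_eq hρ]
    refine integral_mono hf2.integrable (hf1.add hf2).integrable fun p => ?_
    exact le_add_of_nonneg_left (mul_nonneg hρ.1 (sqNorm_nonneg _))
  have hI0 : 0 ≤ I := integral_nonneg fun p => transmitPower_nonneg hρ _
  rw [alpha, ← hI]
  -- If the mean power is zero, division by zero makes `α` zero and the bound is trivial.
  rcases hI0.eq_or_lt with h | h
  · rw [← h]; simpa using hpower.le
  · rw [mul_assoc, div_mul_eq_mul_div, div_le_iff₀ h]
    gcongr

end Moments

end LMSSystem

/-! ### Deviation of the interference from its conditional mean. -/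

lemma Fin.sum_erase_eq_sum_succAbove {n : ℕ} {M : Type*} [AddCommGroup M] (k : Fin (n + 1))
    (f : Fin (n + 1) → M) : ∑ i ∈ Finset.univ.erase k, f i = ∑ j, f (k.succAbove j) := by
  rw [Finset.sum_erase_eq_sub (Finset.mem_univ k), Fin.sum_univ_succAbove f k]
  abel

namespace LMSSystem

variable {S : LMSSystem} (hm : ∀ i, 0 < S.m i) (hΩ : ∀ i, 0 < S.Ω i)

include hm hΩ

lemma finiteMoments_matchedFilter (N K : ℕ) (k i : Fin K) :
    FiniteMoments (fun h : Fin K → Fin N → ℂ => ‖h k ⬝ᵥ star (h i)‖ ^ 2) (S.channelLaw N K) :=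
  have := isProbabilityMeasure_channelLaw hm hΩ N K
  (FiniteMoments.dotProduct_star (channel_finiteMoments hm hΩ N K k)
    (channel_finiteMoments hm hΩ N K i)).norm.pow 2

lemma finiteMoments_interference (N K : ℕ) (k : Fin K) :
    FiniteMoments (fun h : Fin K → Fin N → ℂ =>
      ∑ i ∈ Finset.univ.erase k, ‖h k ⬝ᵥ star (h i)‖ ^ 2) (S.channelLaw N K) :=
  .sum fun i _ => finiteMoments_matchedFilter hm hΩ N K k i

lemma integral_interference (N K : ℕ) (k : Fin K) :
    ∫ h : Fin K → Fin N → ℂ, ∑ i ∈ Finset.univ.erase k, ‖h k ⬝ᵥ star (h i)‖ ^ 2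
      ∂(S.channelLaw N K) = ∑ i ∈ Finset.univ.erase k, S.momentE N K k i :=
  integral_finsetSum _ fun i _ => (finiteMoments_matchedFilter hm hΩ N K k i).integrable

/-- The interference power deviates from its conditional mean given the channel of user `k` by
little in mean square. -/
lemma integral_interference_sub_sq_le (N K : ℕ) (k : Fin K) :
    ∫ h : Fin K → Fin N → ℂ, (∑ i ∈ Finset.univ.erase k, ‖h k ⬝ᵥ star (h i)‖ ^ 2
      - ((∑ i ∈ Finset.univ.erase k, S.meanC i ^ 2) * ‖∑ t, h k t‖ ^ 2
        + (∑ i ∈ Finset.univ.erase k, (S.momentA i - S.meanC i ^ 2)) * sqNorm (h k))) ^ 2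
      ∂(S.channelLaw N K) ≤
    (∑ i ∈ Finset.univ.erase k, (8 * N * (S.meanC i ^ 2 * (S.momentA i - S.meanC i ^ 2))
      + 6 * ∫ z, ‖z - (S.meanC i : ℂ)‖ ^ 4 ∂(S.entryLaw i))) * S.momentD N K k := by
  obtain _ | n := K
  · exact k.elim0
  have := isProbabilityMeasure_entryLaw hm hΩ
  have hF := entryLaw_finiteMoments hm hΩ
  have hx (j : ℕ) := finiteMoments_entry (hF j) (ι := Fin N)
  have hQ (j : ℕ) := FiniteMoments.sqNorm (N := N) (hx j)
  have hs (j : ℕ) : FiniteMoments (fun x : Fin N → ℂ => ‖∑ t, x t‖ ^ 2)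
      (Measure.pi fun _ => S.entryLaw j) := (FiniteMoments.sum fun t _ => hx j t).norm.pow 2
  set P := Measure.pi fun _ : Fin N => S.entryLaw k with hP
  set ρ := fun j : Fin n => Measure.pi fun _ : Fin N => S.entryLaw (k.succAbove j) with hρ
  -- `G j u` is the mean interfering power of the `j`-th other user given that user `k` has channel
  -- `u`, and `B j u` below bounds its conditional variance, using `|∑ u_t|² ≤ N ‖u‖²`.
  let G : Fin n → (Fin N → ℂ) → ℝ := fun j u =>
    ‖∑ t, u t‖ ^ 2 * ‖(S.meanC (k.succAbove j) : ℂ)‖ ^ 2 + (∑ t, ‖u t‖ ^ 2) *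
      (∫ z, ‖z‖ ^ 2 ∂(S.entryLaw (k.succAbove j)) - ‖(S.meanC (k.succAbove j) : ℂ)‖ ^ 2)
  let d : Fin n → (Fin N → ℂ) → (Fin N → ℂ) → ℝ := fun j u y => ‖u ⬝ᵥ star y‖ ^ 2 - G j u
  let B : Fin n → (Fin N → ℂ) → ℝ := fun j u =>
    (8 * N * (S.meanC (k.succAbove j) ^ 2 *
        (S.momentA (k.succAbove j) - S.meanC (k.succAbove j) ^ 2))
      + 6 * ∫ z, ‖z - (S.meanC (k.succAbove j) : ℂ)‖ ^ 4 ∂(S.entryLaw (k.succAbove j))) *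
        sqNorm u ^ 2
  have hG (j : Fin n) : FiniteMoments (G j) P :=
    ((hs k).mul (.const _)).add ((hQ k).mul (.const _))
  have hw (j : Fin n) (u : Fin N → ℂ) : FiniteMoments (fun y : Fin N → ℂ => ‖u ⬝ᵥ star y‖ ^ 2)
      (ρ j) := (FiniteMoments.dotProduct_star (fun t => .const (u t)) (hx _)).norm.pow 2
  have hkey := integral_sq_sum_le (P := P) (ρ := ρ) (d := d) (B := B)
    (fun j => ((FiniteMoments.dotProduct_star (fun t => (hx k t).comp_fst _)
      (fun t => (hx _ t).comp_snd _)).norm.pow 2).sub ((hG j).comp_fst _))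
    (fun j u => (hw j u).sub (.const _))
    (fun j u => by
      simp only [d]
      rw [integral_sub (hw j u).integrable (integrable_const _)]
      simp only [ρ]
      rw [integral_norm_dotProduct_sq (hF _) (integral_entryLaw hm hΩ _)]
      simp [G])
    (fun j u => by
      refine (integral_sq_norm_dotProduct_sq_sub_le (hF _) (integral_entryLaw hm hΩ _) u).trans ?_
      have h1 := norm_sum_sq_le u
      have h2 := sqNorm_nonneg u
      have h3 := sub_nonneg.2 (meanC_sq_le_momentA hm hΩ (k.succAbove j))
      rw [norm_meanC hm hΩ]
      change 8 * (‖∑ t, u t‖ ^ 2 * _) * (sqNorm u * (S.momentA (k.succAbove j) - _)) +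
        6 * _ * sqNorm u ^ 2 ≤ B j u
      have h4 : 8 * (‖∑ t, u t‖ ^ 2 * S.meanC (k.succAbove j) ^ 2) *
          (sqNorm u * (S.momentA (k.succAbove j) - S.meanC (k.succAbove j) ^ 2)) ≤
          8 * (N * sqNorm u * S.meanC (k.succAbove j) ^ 2) *
          (sqNorm u * (S.momentA (k.succAbove j) - S.meanC (k.succAbove j) ^ 2)) := by
        gcongr
      refine (add_le_add_left h4 _).trans (le_of_eq ?_)
      simp only [B]
      ring)
    (fun j => (((hQ k).pow 2).const_mul _).integrable)
  -- Splits the channel law into user `k` and the remaining users, which is the product to condition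
  -- on.
  have hmp := measurePreserving_piFinSuccAbove (α := fun _ => Fin N → ℂ)
    (fun i : Fin (n + 1) => Measure.pi fun _ : Fin N => S.entryLaw i) k
  have hT := hmp.integral_comp_of_aestronglyMeasurable
    (f := fun p : (Fin N → ℂ) × (Fin n → Fin N → ℂ) => (∑ j, d j p.1 (p.2 j)) ^ 2)
    (((FiniteMoments.sum fun j _ => ((FiniteMoments.dotProduct_star
      (U := fun p : (Fin N → ℂ) × (Fin n → Fin N → ℂ) => p.1)
      (W := fun p : (Fin N → ℂ) × (Fin n → Fin N → ℂ) => p.2 j)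
      (fun t => (hx k t).comp_fst (Measure.pi ρ))
      (fun t => ((hx (k.succAbove j) t).comp (measurePreserving_eval ρ j)).comp_snd P)).norm.pow
        2).sub ((hG j).comp_fst (Measure.pi ρ))).pow 2).aestronglyMeasurable)
  have e (h : Fin (n + 1) → Fin N → ℂ) :
      ∑ i ∈ Finset.univ.erase k, ‖h k ⬝ᵥ star (h i)‖ ^ 2
      - ((∑ i ∈ Finset.univ.erase k, S.meanC i ^ 2) * ‖∑ t, h k t‖ ^ 2
        + (∑ i ∈ Finset.univ.erase k, (S.momentA i - S.meanC i ^ 2)) * sqNorm (h k)) =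
      ∑ j, d j (h k) (h (k.succAbove j)) := by
    simp only [Fin.sum_erase_eq_sum_succAbove, d, G, Finset.sum_sub_distrib,
      Finset.sum_add_distrib, norm_meanC hm hΩ, ← Finset.mul_sum]
    simp only [sqNorm, momentA]
    ring
  simp only [e]
  refine (hT.trans_le hkey).trans (le_of_eq ?_)
  rw [Fin.sum_erase_eq_sum_succAbove, Finset.sum_mul]
  refine Finset.sum_congr rfl fun j _ => ?_
  simp only [B]
  rw [integral_const_mul, momentD,
    (measurePreserving_user hm hΩ N (n + 1) k).integral_comp_of_aestronglyMeasurable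
      (f := fun x => sqNorm x ^ 2) ((hQ k).pow 2).aestronglyMeasurable]

end LMSSystem

/-! ### Relative variance of the interference, uniformly in the number of users. -/

lemma HasRelVarLE.of_integral_sub_sq_le {α : Type*} {mα : MeasurableSpace α} {P : Measure α}
    [IsProbabilityMeasure P] {f g : α → ℝ} {δ δ' : ℝ} (hδ : 0 ≤ δ) (hδ' : 0 ≤ δ')
    (hg : HasRelVarLE g P δ) (hf : FiniteMoments f P) (hfg : ∫ x, f x ∂P = ∫ x, g x ∂P)
    (h : ∫ x, (f x - g x) ^ 2 ∂P ≤ δ' * (∫ x, f x ∂P) ^ 2) :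
    HasRelVarLE f P (2 * δ' + 2 * δ) := by
  have hgv := hg.3
  have hg0 := hg.2
  rw [← hfg] at hgv hg0
  set E := ∫ x, f x ∂P
  refine .of_integral_sq_sub_le hf (a := E) (b := E) (by positivity) hg0 le_rfl ?_
  have f1 := ((hf.sub hg.1).pow 2).const_mul 2
  have f2 := ((hg.1.sub (.const E)).pow 2).const_mul 2
  refine (integral_mono ((hf.sub (.const E)).pow 2).integrable (f1.add f2).integrable
    fun x => ?_).trans ?_
  · nlinarith [sq_nonneg ((f x - g x) - (g x - E))]
  · rw [integral_add f1.integrable f2.integrable, integral_const_mul, integral_const_mul]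
    linarith

/-- For `n ≥ 2`, `n (n - 1) ≥ n²/2`, so `E ≥ x + y` with `x = n A a` and `y = n² C s / 2`. The part
proportional to `s` is compared with `y²` and the part proportional to `a` with `2 x y`; in each,
one factor `s` is bounded below by `c`. Hence no constant depends on how `s` and `a` grow. -/
lemma interference_scalar_bound {n a s A C c B q m E : ℝ} (hn : 2 ≤ n) (hA : 0 < A) (hC : 0 < C)
    (hc : 0 < c) (ha : 0 ≤ a) (hcs : c ≤ s) (hB : 0 ≤ B) (hq : 0 ≤ q) (hm : 0 ≤ m)
    (hE : E = n * A * a + n * (n - 1) * C * s) :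
    (8 * n * (B * s) + 6 * (q * B * a)) * (m * n ^ 2) ≤
      (m * B * (32 / (C ^ 2 * c) + 6 * q / (A * C * c))) / n * E ^ 2 := by
  have hs : 0 ≤ s := hc.le.trans hcs
  have hn0 : 0 < n := by linarith
  have hx : 0 ≤ n * A * a := by positivity
  have hy : 0 ≤ n ^ 2 / 2 * C * s := by positivity
  have hxy : n * A * a + n ^ 2 / 2 * C * s ≤ E := by
    rw [hE]
    nlinarith [mul_nonneg (mul_nonneg (mul_nonneg hn0.le (sub_nonneg.2 hn)) hC.le) hs]
  have hsq : (n * A * a + n ^ 2 / 2 * C * s) ^ 2 ≤ E ^ 2 := by gcongr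
  have h1 : n ^ 4 / 4 * C ^ 2 * c * s ≤ E ^ 2 := by
    have : n ^ 4 / 4 * C ^ 2 * c * s ≤ n ^ 4 / 4 * C ^ 2 * s * s := by gcongr
    nlinarith [sq_nonneg (n * A * a), mul_nonneg hx hy]
  have h2 : n ^ 3 * A * C * c * a ≤ E ^ 2 := by
    have : n ^ 3 * A * C * c * a ≤ n ^ 3 * A * C * s * a := by gcongr
    nlinarith [sq_nonneg (n * A * a), sq_nonneg (n ^ 2 / 2 * C * s)]
  have e : (8 * n * (B * s) + 6 * (q * B * a)) * (m * n ^ 2) =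
      m * B * (32 / (C ^ 2 * c)) / n * (n ^ 4 / 4 * C ^ 2 * c * s) +
        m * B * (6 * q / (A * C * c)) / n * (n ^ 3 * A * C * c * a) := by
    field_simp
    ring
  rw [e, mul_add, add_div, add_mul]
  gcongr

namespace LMSSystem

variable {S : LMSSystem} (hm : ∀ i, 0 < S.m i) (hΩ : ∀ i, 0 < S.Ω i)

include hm hΩ

omit hm hΩ in
lemma momentD_nonneg (S : LMSSystem) (N K : ℕ) (k : Fin K) : 0 ≤ S.momentD N K k :=
  integral_nonneg fun _ => sq_nonneg _

lemma momentD_le (N K : ℕ) (hN : 1 ≤ N) (k : Fin K) :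
    S.momentD N K k ≤ (∫ z, ‖z‖ ^ 4 ∂(S.entryLaw k)) * (N : ℝ) ^ 2 := by
  rw [momentD_eq hm hΩ, integral_entryLaw_norm_four hm hΩ]
  have h1 : (1 : ℝ) ≤ N := by exact_mod_cast hN
  have h2 := hm k
  have h3 := hΩ k
  have h4 : 0 ≤ 4 * (S.b k : ℝ) ^ 2 + 4 * S.b k * S.Ω k + S.Ω k ^ 2 / S.m k := by positivity
  nlinarith [mul_nonneg h4 (mul_nonneg (sub_nonneg.2 h1) (zero_le_one.trans h1))]

lemma integral_norm_sum_channel (N K : ℕ) (k : Fin K) :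
    ∫ h, ‖∑ t, h k t‖ ^ 2 ∂(S.channelLaw N K) =
      N * S.momentA k + N * (N - 1) * S.meanC k ^ 2 := by
  have := isProbabilityMeasure_entryLaw hm hΩ k
  have hF := entryLaw_finiteMoments hm hΩ k
  rw [(measurePreserving_user hm hΩ N K k).integral_comp_of_aestronglyMeasurable
    (f := fun x => ‖∑ t, x t‖ ^ 2) (by fun_prop), integral_norm_sum_entries_sq hF,
    integral_entryLaw hm hΩ, norm_meanC hm hΩ]
  rfl

/-- One factor of each quadratic expression is replaced by the uniform bound `B`, leaving the linear
sums of `C_i²` and `A_i` that also make up the mean interference. -/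
lemma sum_conditionalVariance_le {m₀ B : ℝ} (hm₀ : 0 < m₀) (hmm : ∀ i, m₀ ≤ S.m i)
    (hAB : ∀ i, S.momentA i ≤ B) (N : ℕ) {K : ℕ} (T : Finset (Fin K)) :
    ∑ i ∈ T, (8 * N * (S.meanC i ^ 2 * (S.momentA i - S.meanC i ^ 2))
      + 6 * ∫ z, ‖z - (S.meanC i : ℂ)‖ ^ 4 ∂(S.entryLaw i)) ≤
    8 * N * (B * ∑ i ∈ T, S.meanC i ^ 2)
      + 6 * (16 * (2 + 1 / m₀) * B * ∑ i ∈ T, S.momentA i) := by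
  rw [Finset.mul_sum, Finset.mul_sum, Finset.mul_sum, Finset.mul_sum, ← Finset.sum_add_distrib]
  refine Finset.sum_le_sum fun i _ => ?_
  have h1 := integral_entryLaw_norm_sub_four_le hm hΩ hm₀ hmm i
  have h2 := momentA_pos hm hΩ i
  have h4 : S.momentA i - S.meanC i ^ 2 ≤ B := by linarith [sq_nonneg (S.meanC i), hAB i]
  have h5 : 16 * (2 + 1 / m₀) * S.momentA i ^ 2 ≤ 16 * (2 + 1 / m₀) * B * S.momentA i := by
    rw [sq, mul_assoc _ B]
    have := hAB i
    gcongr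
  have h6 : S.meanC i ^ 2 * (S.momentA i - S.meanC i ^ 2) ≤ B * S.meanC i ^ 2 := by
    rw [mul_comm]; gcongr
  have h7 : 8 * N * (S.meanC i ^ 2 * (S.momentA i - S.meanC i ^ 2)) ≤
      8 * N * (B * S.meanC i ^ 2) := by gcongr
  linarith

lemma exists_hasRelVarLE_channel {m₀ M : ℝ} (hm₀ : 0 < m₀) (hmm : ∀ i, m₀ ≤ S.m i)
    (hΩM : ∀ i, S.Ω i ≤ M) (hbM : ∀ i, (S.b i : ℝ) ≤ M) (k : ℕ) :
    ∃ κ : ℝ, 0 ≤ κ ∧ ∀ N K : ℕ, 2 ≤ N → 2 ≤ K → ∀ hk : k < K,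
      HasRelVarLE (fun h : Fin K → Fin N → ℂ => sqNorm (h ⟨k, hk⟩)) (S.channelLaw N K) (κ / N) ∧
      HasRelVarLE (fun h : Fin K → Fin N → ℂ => sqNorm (h ⟨k, hk⟩) ^ 2) (S.channelLaw N K)
        (κ / N) ∧
      HasRelVarLE (fun h : Fin K → Fin N → ℂ =>
        ∑ i ∈ Finset.univ.erase ⟨k, hk⟩, ‖h ⟨k, hk⟩ ⬝ᵥ star (h i)‖ ^ 2) (S.channelLaw N K)
        (κ / N) := by
  have hpk := isProbabilityMeasure_entryLaw hm hΩ k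
  have hA := momentA_pos hm hΩ
  have hC := meanC_pos hm hΩ
  have hCA := meanC_sq_le_momentA hm hΩ
  obtain ⟨κ₀, hκ₀, hκ⟩ := exists_hasRelVarLE (entryLaw_finiteMoments hm hΩ k)
    (by rw [integral_entryLaw hm hΩ]; exact_mod_cast (hC k).ne') (hA k)
  -- An interferer among the first two users is present in every system with `K ≥ 2`; its `C_j²`
  -- bounds `s` below independently of `K`.
  obtain ⟨j, hj2, hjk⟩ : ∃ j, j < 2 ∧ j ≠ k := by
    rcases eq_or_ne k 0 with rfl | h
    · exact ⟨1, by norm_num, by norm_num⟩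
    · exact ⟨0, by norm_num, h.symm⟩
  obtain ⟨B, hB, hAM⟩ : ∃ B, 0 ≤ B ∧ ∀ i, S.momentA i ≤ B :=
    ⟨3 * M, by linarith [hΩ 0, hΩM 0], fun i => by
      rw [momentA_eq hm hΩ]; linarith [hΩM i, hbM i]⟩
  set m4 := ∫ z, ‖z‖ ^ 4 ∂(S.entryLaw k)
  have hm4 : 0 ≤ m4 := by positivity
  set q := 16 * (2 + 1 / m₀)
  have hq : 0 ≤ q := by positivity
  have hCk := hC k
  have hCj := hC j
  have hAk := hA k
  set κ₁ := m4 * B * (32 / ((S.meanC k ^ 2) ^ 2 * S.meanC j ^ 2) +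
    6 * q / (S.momentA k * S.meanC k ^ 2 * S.meanC j ^ 2))
  have hκ₁ : 0 ≤ κ₁ := by positivity
  -- The conditional mean has relative variance `2 κ₀ / N` and the deviation from it contributes `κ₁
  -- / N`; combining them doubles each.
  refine ⟨4 * κ₀ + 2 * κ₁, by positivity, fun N K hN hK hk => ?_⟩
  obtain ⟨hQ, hQ2, hs⟩ := hκ N (by omega)
  have hmp := measurePreserving_user hm hΩ N K ⟨k, hk⟩
  have hprob := isProbabilityMeasure_channelLaw hm hΩ N K
  have hN2 : (2 : ℝ) ≤ N := by exact_mod_cast hN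
  have hle : κ₀ / N ≤ (4 * κ₀ + 2 * κ₁) / N := by gcongr; linarith
  have hQc := hQ.comp hmp
  have hsc := hs.comp hmp
  have hQm : FiniteMoments (fun h : Fin K → Fin N → ℂ => sqNorm (h ⟨k, hk⟩))
    (S.channelLaw N K) := hQc.1
  have hsm : FiniteMoments (fun h : Fin K → Fin N → ℂ => ‖∑ t, h ⟨k, hk⟩ t‖ ^ 2)
    (S.channelLaw N K) := hsc.1
  refine ⟨hQc.mono hle, (hQ2.comp hmp).mono hle, ?_⟩
  set T : Finset (Fin K) := Finset.univ.erase ⟨k, hk⟩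
  set s := ∑ i ∈ T, S.meanC i ^ 2 with hs_def
  set v := ∑ i ∈ T, (S.momentA i - S.meanC i ^ 2) with hv_def
  set a := ∑ i ∈ T, S.momentA i
  have hv : v = a - s := by rw [hv_def, Finset.sum_sub_distrib]
  have hv0 : 0 ≤ v := Finset.sum_nonneg fun i _ => sub_nonneg.2 (hCA i)
  have hs0 : 0 ≤ s := Finset.sum_nonneg fun i _ => sq_nonneg _
  have ha0 : 0 ≤ a := Finset.sum_nonneg fun i _ => (hA i).le
  have hjs : S.meanC j ^ 2 ≤ s :=
    Finset.single_le_sum (f := fun i : Fin K => S.meanC i ^ 2) (fun i _ => sq_nonneg _)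
      (Finset.mem_erase.2 ⟨fun h => hjk (congrArg Fin.val h),
        Finset.mem_univ (⟨j, by omega⟩ : Fin K)⟩)
  have hG : HasRelVarLE (fun h : Fin K → Fin N → ℂ =>
      s * ‖∑ t, h ⟨k, hk⟩ t‖ ^ 2 + v * sqNorm (h ⟨k, hk⟩)) (S.channelLaw N K) (2 * (κ₀ / N)) :=
    .add (by positivity) (hsc.const_mul hs0) (hQc.const_mul hv0)
  have hX := finiteMoments_interference hm hΩ N K ⟨k, hk⟩
  set E := ∑ i ∈ T, S.momentE N K ⟨k, hk⟩ i with hE_def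
  have hE : E = N * S.momentA k * a + N * (N - 1) * S.meanC k ^ 2 * s := by
    rw [hE_def, Finset.mul_sum, Finset.mul_sum, ← Finset.sum_add_distrib]
    exact Finset.sum_congr rfl fun i hi => momentE_eq hm hΩ N K (Finset.ne_of_mem_erase hi)
  have hXE : ∫ h : Fin K → Fin N → ℂ, ∑ i ∈ T, ‖h ⟨k, hk⟩ ⬝ᵥ star (h i)‖ ^ 2
      ∂(S.channelLaw N K) = E := integral_interference hm hΩ N K ⟨k, hk⟩
  have hGE : ∫ h : Fin K → Fin N → ℂ, s * ‖∑ t, h ⟨k, hk⟩ t‖ ^ 2 + v * sqNorm (h ⟨k, hk⟩)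
      ∂(S.channelLaw N K) = E := by
    rw [integral_add (hsm.const_mul s).integrable (hQm.const_mul v).integrable,
      integral_const_mul, integral_const_mul, integral_sqNorm_channel hm hΩ,
      integral_norm_sum_channel hm hΩ, hE, hv]
    ring
  have hE0 : 0 ≤ E := by rw [← hGE]; exact hG.2
  have hdev := integral_interference_sub_sq_le hm hΩ N K ⟨k, hk⟩
  have hbound : (∑ i ∈ T, (8 * N * (S.meanC i ^ 2 * (S.momentA i - S.meanC i ^ 2))
      + 6 * ∫ z, ‖z - (S.meanC i : ℂ)‖ ^ 4 ∂(S.entryLaw i))) * S.momentD N K ⟨k, hk⟩ ≤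
      κ₁ / N * E ^ 2 := by
    have h1 := sum_conditionalVariance_le hm hΩ hm₀ hmm hAM N T
    have h2 := momentD_le hm hΩ N K (by omega) ⟨k, hk⟩
    have h3 : 0 ≤ 8 * N * (B * s) + 6 * (q * B * a) :=
      add_nonneg (mul_nonneg (by linarith) (mul_nonneg hB hs0))
        (mul_nonneg (by norm_num) (mul_nonneg (mul_nonneg hq hB) ha0))
    exact (mul_le_mul h1 h2 (momentD_nonneg S N K ⟨k, hk⟩) h3).trans
      (interference_scalar_bound hN2 hAk (pow_pos hCk 2) (pow_pos hCj 2) ha0 hjs hB hq hm4 hE)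
  have hdev' := hdev.trans hbound
  rw [← hXE] at hdev'
  refine (hG.of_integral_sub_sq_le (by positivity) (by positivity) hX (hXE.trans hGE.symm)
    hdev').mono (le_of_eq ?_)
  ring

end LMSSystem

/-! ### The rate as a difference of logarithms of two powers. -/

namespace LMSSystem

variable {S : LMSSystem}

/-- Power of the private message of user `k` at user `k`. -/
noncomputable def signal (S : LMSSystem) (N K : ℕ) (k : Fin K) (h : Fin K → Fin N → ℂ) : ℝ :=
  S.alpha N K * (1 - S.ρ) * sqNorm (h k) ^ 2 + S.alpha N K * (1 - S.ρ) * sqNorm (h k) * S.errVar k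

/-- Power of the noise and of the private messages of the other users at user `k`. -/
noncomputable def disturbance (S : LMSSystem) (N K : ℕ) (k : Fin K) (h : Fin K → Fin N → ℂ) : ℝ :=
  S.noiseVar k + S.alpha N K * (1 - S.ρ) *
    ∑ i ∈ Finset.univ.erase k, (‖h k ⬝ᵥ star (h i)‖ ^ 2 + sqNorm (h k) * S.errVar i)

lemma signal_nonneg (hpower : 0 < S.power) (hρ : S.ρ ∈ Set.Icc (0 : ℝ) 1) (N K : ℕ) (k : Fin K)
    (h : Fin K → Fin N → ℂ) : 0 ≤ S.signal N K k h := by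
  have hβ := alpha_mul_nonneg hpower hρ N K
  have hQ := sqNorm_nonneg (h k)
  unfold signal
  positivity

lemma noiseVar_le_disturbance (hpower : 0 < S.power) (hρ : S.ρ ∈ Set.Icc (0 : ℝ) 1) (N K : ℕ)
    (k : Fin K) (h : Fin K → Fin N → ℂ) : S.noiseVar k ≤ S.disturbance N K k h := by
  have hQ := sqNorm_nonneg (h k)
  exact le_add_of_nonneg_right (mul_nonneg (alpha_mul_nonneg hpower hρ N K)
    (Finset.sum_nonneg fun i _ => by positivity))

lemma logb_one_add_div {x y : ℝ} (hx : 0 ≤ x) (hy : 0 < y) :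
    Real.logb 2 (1 + x / y) = (Real.log (y + x) - Real.log y) / Real.log 2 := by
  rw [Real.logb, ← Real.log_div (by positivity) hy.ne', add_div, div_self hy.ne']

lemma privateRate_eq (hpower : 0 < S.power) (hρ : S.ρ ∈ Set.Icc (0 : ℝ) 1)
    (hnoise : ∀ i, 0 < S.noiseVar i) (N K : ℕ) (k : Fin K) (h : Fin K → Fin N → ℂ) :
    S.privateRate N K k h = (Real.log (S.disturbance N K k h + S.signal N K k h)
      - Real.log (S.disturbance N K k h)) / Real.log 2 := by
  rw [privateRate, sinr_eq hpower hρ]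
  exact logb_one_add_div (signal_nonneg hpower hρ N K k h)
    ((hnoise k).trans_le (noiseVar_le_disturbance hpower hρ N K k h))

lemma disturbance_eq (N K : ℕ) (k : Fin K) (h : Fin K → Fin N → ℂ) :
    S.disturbance N K k h = S.noiseVar k + S.alpha N K * (1 - S.ρ) *
      (∑ i ∈ Finset.univ.erase k, ‖h k ⬝ᵥ star (h i)‖ ^ 2
        + (∑ i ∈ Finset.univ.erase k, (S.errVar i : ℝ)) * sqNorm (h k)) := by
  rw [disturbance, Finset.sum_add_distrib, Finset.sum_mul]
  simp only [mul_comm]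

/-! ### Means of the powers and bounds free of the number of users. -/

section Means

variable (hm : ∀ i, 0 < S.m i) (hΩ : ∀ i, 0 < S.Ω i)

include hm hΩ

lemma finiteMoments_sqNorm (N K : ℕ) (k : Fin K) :
    FiniteMoments (fun h : Fin K → Fin N → ℂ => sqNorm (h k)) (S.channelLaw N K) :=
  have := isProbabilityMeasure_channelLaw hm hΩ N K
  .sqNorm (channel_finiteMoments hm hΩ N K k)

lemma finiteMoments_signal (N K : ℕ) (k : Fin K) :
    FiniteMoments (S.signal N K k) (S.channelLaw N K) :=
  have := isProbabilityMeasure_channelLaw hm hΩ N K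
  have hQ := finiteMoments_sqNorm hm hΩ N K k
  ((hQ.pow 2).const_mul _).add ((hQ.const_mul _).mul (.const _))

lemma finiteMoments_disturbance (N K : ℕ) (k : Fin K) :
    FiniteMoments (S.disturbance N K k) (S.channelLaw N K) :=
  have := isProbabilityMeasure_channelLaw hm hΩ N K
  have hQ := finiteMoments_sqNorm hm hΩ N K k
  (FiniteMoments.const _).add ((FiniteMoments.sum fun i _ =>
    (finiteMoments_matchedFilter hm hΩ N K k i).add (hQ.mul (.const _))).const_mul _)

lemma integral_signal (N K : ℕ) (k : Fin K) : ∫ h, S.signal N K k h ∂(S.channelLaw N K) =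
    S.alpha N K * (1 - S.ρ) * S.momentD N K k
      + S.alpha N K * (1 - S.ρ) * S.errVar k * N * S.momentA k := by
  have := isProbabilityMeasure_channelLaw hm hΩ N K
  have hQ := finiteMoments_sqNorm hm hΩ N K k
  unfold signal
  rw [integral_add ((hQ.pow 2).const_mul _).integrable
    ((hQ.const_mul _).mul (.const _)).integrable, integral_const_mul, integral_mul_const,
    integral_const_mul, integral_sqNorm_channel hm hΩ, momentD]
  ring

lemma integral_disturbance (N K : ℕ) (k : Fin K) :
    ∫ h, S.disturbance N K k h ∂(S.channelLaw N K) =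
    S.noiseVar k + S.alpha N K * (1 - S.ρ) *
        ∑ i ∈ Finset.univ.erase k, (S.momentE N K k i + S.errVar i * N * S.momentA k) := by
  have := isProbabilityMeasure_channelLaw hm hΩ N K
  have hQ := finiteMoments_sqNorm hm hΩ N K k
  have hX := finiteMoments_matchedFilter hm hΩ N K k
  have hXQ (i : Fin K) := (hX i).add (hQ.mul (.const (S.errVar i : ℝ)))
  unfold disturbance
  rw [integral_add (integrable_const _) ((FiniteMoments.sum fun i _ => hXQ i).const_mul
    _).integrable, integral_const_mul, integral_finsetSum _ fun i _ => (hXQ i).integrable]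
  simp only [integral_const, probReal_univ, one_smul]
  congr 2
  refine Finset.sum_congr rfl fun i _ => ?_
  rw [integral_add (hX i).integrable (hQ.mul (.const _)).integrable, integral_mul_const,
    integral_sqNorm_channel hm hΩ, momentE]
  ring

omit hm hΩ in
lemma integral_signal_nonneg (hpower : 0 < S.power) (hρ : S.ρ ∈ Set.Icc (0 : ℝ) 1) (N K : ℕ)
    (k : Fin K) : 0 ≤ ∫ h, S.signal N K k h ∂(S.channelLaw N K) :=
  integral_nonneg fun h => signal_nonneg hpower hρ N K k h

lemma noiseVar_le_integral_disturbance (hpower : 0 < S.power) (hρ : S.ρ ∈ Set.Icc (0 : ℝ) 1)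
    (N K : ℕ) (k : Fin K) : S.noiseVar k ≤ ∫ h, S.disturbance N K k h ∂(S.channelLaw N K) := by
  have := isProbabilityMeasure_channelLaw hm hΩ N K
  simpa using integral_mono (integrable_const (S.noiseVar k))
    (finiteMoments_disturbance hm hΩ N K k).integrable
    (noiseVar_le_disturbance hpower hρ N K k)

lemma approxPrivateRate_eq (hpower : 0 < S.power) (hρ : S.ρ ∈ Set.Icc (0 : ℝ) 1)
    (hnoise : ∀ i, 0 < S.noiseVar i) (N K : ℕ) (k : Fin K) :
    S.approxPrivateRate N K k =
      (Real.log (∫ h, S.disturbance N K k h + S.signal N K k h ∂(S.channelLaw N K))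
        - Real.log (∫ h, S.disturbance N K k h ∂(S.channelLaw N K))) / Real.log 2 := by
  rw [integral_add (finiteMoments_disturbance hm hΩ N K k).integrable
    (finiteMoments_signal hm hΩ N K k).integrable, ← logb_one_add_div
    (integral_signal_nonneg hpower hρ N K k)
    ((hnoise k).trans_le (noiseVar_le_integral_disturbance hm hΩ hpower hρ N K k)),
    integral_signal hm hΩ, integral_disturbance hm hΩ, approxPrivateRate]

lemma integrable_log_powers (hpower : 0 < S.power) (hρ : S.ρ ∈ Set.Icc (0 : ℝ) 1)
    (hnoise : ∀ i, 0 < S.noiseVar i) (N K : ℕ) (k : Fin K) :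
    Integrable (fun h => Real.log (S.disturbance N K k h + S.signal N K k h)) (S.channelLaw N K) ∧
      Integrable (fun h => Real.log (S.disturbance N K k h)) (S.channelLaw N K) := by
  have := isProbabilityMeasure_channelLaw hm hΩ N K
  have h1 := noiseVar_le_disturbance hpower hρ N K k
  exact ⟨((finiteMoments_disturbance hm hΩ N K k).add
      (finiteMoments_signal hm hΩ N K k)).integrable_log (hnoise k)
      fun h => (h1 h).trans (le_add_of_nonneg_right (signal_nonneg hpower hρ N K k h)),
    (finiteMoments_disturbance hm hΩ N K k).integrable_log (hnoise k) h1⟩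

lemma integrable_privateRate (hpower : 0 < S.power) (hρ : S.ρ ∈ Set.Icc (0 : ℝ) 1)
    (hnoise : ∀ i, 0 < S.noiseVar i) (N K : ℕ) (k : Fin K) :
    Integrable (S.privateRate N K k) (S.channelLaw N K) := by
  obtain ⟨h1, h2⟩ := integrable_log_powers hm hΩ hpower hρ hnoise N K k
  rw [funext (privateRate_eq hpower hρ hnoise N K k)]
  exact (h1.sub h2).div_const _

lemma ergodicPrivateRate_sub_approxPrivateRate (hpower : 0 < S.power)
    (hρ : S.ρ ∈ Set.Icc (0 : ℝ) 1) (hnoise : ∀ i, 0 < S.noiseVar i) (N K : ℕ) (k : Fin K) :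
    S.ergodicPrivateRate N K k - S.approxPrivateRate N K k =
      ((∫ h, Real.log (S.disturbance N K k h + S.signal N K k h) ∂(S.channelLaw N K)
          - Real.log (∫ h, S.disturbance N K k h + S.signal N K k h ∂(S.channelLaw N K)))
        - (∫ h, Real.log (S.disturbance N K k h) ∂(S.channelLaw N K)
          - Real.log (∫ h, S.disturbance N K k h ∂(S.channelLaw N K)))) / Real.log 2 := by
  obtain ⟨h1, h2⟩ := integrable_log_powers hm hΩ hpower hρ hnoise N K k
  rw [approxPrivateRate_eq hm hΩ hpower hρ hnoise, ergodicPrivateRate,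
    funext (privateRate_eq hpower hρ hnoise N K k), integral_div, integral_sub h1 h2]
  ring

lemma alpha_mul_momentA_le (hpower : 0 < S.power) (hρ : S.ρ ∈ Set.Icc (0 : ℝ) 1) (N K : ℕ)
    (k : Fin K) : S.alpha N K * (1 - S.ρ) * (N * S.momentA k) ≤ S.power := by
  refine le_trans ?_ (alpha_mul_le hm hΩ hpower hρ N K)
  have h := alpha_mul_nonneg hpower hρ N K
  have hnn (i : Fin K) : 0 ≤ S.momentA i + S.errVar i :=
    add_nonneg (momentA_pos hm hΩ i).le (S.errVar i).2
  have h1 := Finset.single_le_sum (f := fun i : Fin K => S.momentA i + (S.errVar i : ℝ))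
    (fun i _ => hnn i) (Finset.mem_univ k)
  have h2 : S.momentA k ≤ ∑ i : Fin K, (S.momentA i + (S.errVar i : ℝ)) :=
    le_trans (le_add_of_nonneg_right (S.errVar k).2) h1
  gcongr

/-- Since `C² ≤ A`, each interferer contributes at most `N² A_k (A_i + σ_{e_i}²)` before scaling,
and the power normalization bounds the scaled sum over `i` by `P_t A_k N`. -/
lemma integral_disturbance_le (hpower : 0 < S.power) (hρ : S.ρ ∈ Set.Icc (0 : ℝ) 1) (N K : ℕ)
    (hN : 1 ≤ N) (k : Fin K) : ∫ h, S.disturbance N K k h ∂(S.channelLaw N K) ≤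
      S.noiseVar k + S.power * S.momentA k * N := by
  rw [integral_disturbance hm hΩ]
  have hβ := alpha_mul_nonneg hpower hρ N K
  have hP := alpha_mul_le hm hΩ hpower hρ N K
  have hAk := momentA_pos hm hΩ k
  have hN1 : (1 : ℝ) ≤ N := by exact_mod_cast hN
  set β := S.alpha N K * (1 - S.ρ)
  have h1 : ∑ i ∈ Finset.univ.erase k, (S.momentE N K k i + S.errVar i * N * S.momentA k) ≤
      ∑ i : Fin K, N * S.momentA k * (N * (S.momentA i + S.errVar i)) := by
    refine (Finset.sum_le_sum fun i hi => ?_).trans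
      (Finset.sum_le_sum_of_subset_of_nonneg (Finset.erase_subset _ _) fun i _ _ => ?_)
    · rw [momentE_eq hm hΩ N K (Finset.ne_of_mem_erase hi)]
      have h2 := meanC_sq_le_momentA hm hΩ k
      have h3 := meanC_sq_le_momentA hm hΩ i
      have h4 : S.meanC k ^ 2 * S.meanC i ^ 2 ≤ S.momentA k * S.momentA i := by gcongr
      have h5 : (0 : ℝ) ≤ N * (N - 1) := mul_nonneg (by linarith) (by linarith)
      have h6 : (0 : ℝ) ≤ S.errVar i * (N * S.momentA k * (N - 1)) :=
        mul_nonneg (S.errVar i).2 (mul_nonneg (by positivity) (by linarith))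
      nlinarith [mul_le_mul_of_nonneg_left h4 h5]
    · have := momentA_pos hm hΩ i
      positivity
  rw [← Finset.mul_sum, ← Finset.mul_sum] at h1
  calc S.noiseVar k + β * ∑ i ∈ Finset.univ.erase k,
        (S.momentE N K k i + S.errVar i * N * S.momentA k)
      ≤ S.noiseVar k + β * (N * S.momentA k *
          (N * ∑ i : Fin K, (S.momentA i + (S.errVar i : ℝ)))) := by gcongr
    _ = S.noiseVar k + N * S.momentA k *
          (β * (N * ∑ i : Fin K, (S.momentA i + (S.errVar i : ℝ)))) := by ring
    _ ≤ S.noiseVar k + N * S.momentA k * S.power := by gcongr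
    _ = _ := by ring

/-- `E‖h_k‖⁴` is of order `N²`, and `α (1 - ρ) N A_k ≤ P_t` absorbs one factor `N`. -/
lemma integral_signal_le (hpower : 0 < S.power) (hρ : S.ρ ∈ Set.Icc (0 : ℝ) 1) (N K : ℕ)
    (hN : 1 ≤ N) (k : Fin K) : ∫ h, S.signal N K k h ∂(S.channelLaw N K) ≤
      S.power * ((∫ z, ‖z‖ ^ 4 ∂(S.entryLaw k)) / S.momentA k * N + S.errVar k) := by
  rw [integral_signal hm hΩ]
  have hβ := alpha_mul_nonneg hpower hρ N K
  have hP := alpha_mul_momentA_le hm hΩ hpower hρ N K k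
  have hAk := momentA_pos hm hΩ k
  have hD := momentD_le hm hΩ N K hN k
  set β := S.alpha N K * (1 - S.ρ)
  set m4 := ∫ z, ‖z‖ ^ 4 ∂(S.entryLaw k)
  have hm4 : 0 ≤ m4 := by positivity
  calc β * S.momentD N K k + β * S.errVar k * N * S.momentA k
      ≤ β * (m4 * (N : ℝ) ^ 2) + β * S.errVar k * N * S.momentA k := by gcongr
    _ = (β * (N * S.momentA k)) * (m4 / S.momentA k * N + S.errVar k) := by field_simp
    _ ≤ _ := by gcongr

end Means

/-! ### The explicit error bound and the limit. -/

open Filter Topology in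
lemma tendsto_log_mul_div_atTop {c : ℝ} (hc : 0 < c) (d : ℝ) :
    Tendsto (fun N : ℕ => (2 + 4 * Real.log (c * N)) * (d / N)) atTop (𝓝 0) := by
  have h1 : Tendsto (fun N : ℕ => Real.log N / N) atTop (𝓝 0) :=
    (Real.isLittleO_log_id_atTop.tendsto_div_nhds_zero).comp tendsto_natCast_atTop_atTop
  have h2 : Tendsto (fun N : ℕ => (2 + 4 * Real.log c) * d / (N : ℝ)) atTop (𝓝 0) :=
    tendsto_const_div_atTop_nhds_zero_nat _
  have h3 := h2.add (h1.const_mul (4 * d))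
  rw [mul_zero, add_zero] at h3
  refine h3.congr' ?_
  filter_upwards [eventually_ge_atTop 1] with N hN
  have hN0 : (0 : ℝ) < N := by exact_mod_cast hN
  rw [Real.log_mul hc.ne' hN0.ne']
  ring

theorem exists_abs_ergodicPrivateRate_sub_le {m₀ M : ℝ} (hm₀ : 0 < m₀) (hmm : ∀ i, m₀ ≤ S.m i)
    (hΩ : ∀ i, 0 < S.Ω i) (hΩM : ∀ i, S.Ω i ≤ M) (hbM : ∀ i, (S.b i : ℝ) ≤ M)
    (hnoise : ∀ i, 0 < S.noiseVar i) (hpower : 0 < S.power) (hρ : S.ρ ∈ Set.Icc (0 : ℝ) 1)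
    (k : ℕ) : ∃ c d : ℝ, 0 < c ∧ ∀ N K : ℕ, 2 ≤ N → 2 ≤ K → ∀ hk : k < K,
      |S.ergodicPrivateRate N K ⟨k, hk⟩ - S.approxPrivateRate N K ⟨k, hk⟩| ≤
        (2 + 4 * Real.log (c * N)) * (d / N) := by
  have hm (i : ℕ) : 0 < S.m i := hm₀.trans_le (hmm i)
  obtain ⟨κ, hκ, H⟩ := exists_hasRelVarLE_channel hm hΩ hm₀ hmm hΩM hbM k
  have hσ := hnoise k
  have hAk := momentA_pos hm hΩ k
  set m4 := ∫ z, ‖z‖ ^ 4 ∂(S.entryLaw k) with hm4_def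
  have hm4 : 0 ≤ m4 := by positivity
  set R := S.noiseVar k + S.power * S.momentA k + S.power * (m4 / S.momentA k + S.errVar k)
    with hR_def
  have hR : 0 < R := by positivity
  -- The two Jensen gaps have relative variances `4κ/N` (total power) and `2κ/N` (disturbance); `8`
  -- exceeds their sum.
  refine ⟨R / S.noiseVar k, 8 * κ / Real.log 2, by positivity, fun N K hN hK hk => ?_⟩
  obtain ⟨hQ, hQ2, hX⟩ := H N K hN hK hk
  have := isProbabilityMeasure_channelLaw hm hΩ N K
  have hN1 : (1 : ℝ) ≤ N := by exact_mod_cast (by omega : 1 ≤ N)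
  have hN0 : (0 : ℝ) < N := by linarith
  have hβ := alpha_mul_nonneg hpower hρ N K
  have hδ : 0 ≤ κ / N := by positivity
  have hdist : HasRelVarLE (S.disturbance N K ⟨k, hk⟩) (S.channelLaw N K) (2 * (κ / N)) := by
    rw [funext (disturbance_eq N K ⟨k, hk⟩)]
    have hs : 0 ≤ ∑ i ∈ Finset.univ.erase (⟨k, hk⟩ : Fin K), (S.errVar i : ℝ) :=
      Finset.sum_nonneg fun i _ => (S.errVar i).2
    exact ((hX.add hδ (hQ.const_mul hs)).const_mul hβ).const_add hσ.le (by positivity)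
  have hsig : HasRelVarLE (S.signal N K ⟨k, hk⟩) (S.channelLaw N K) (2 * (κ / N)) := by
    have e : S.signal N K ⟨k, hk⟩ = fun h => S.alpha N K * (1 - S.ρ) * sqNorm (h ⟨k, hk⟩) ^ 2 +
        S.alpha N K * (1 - S.ρ) * S.errVar k * sqNorm (h ⟨k, hk⟩) := by
      ext h
      simp only [signal]
      ring
    rw [e]
    exact (hQ2.const_mul hβ).add hδ (hQ.const_mul (mul_nonneg hβ (S.errVar k).2))
  have htot := hdist.add (by positivity) hsig
  have hσd := noiseVar_le_disturbance hpower hρ N K ⟨k, hk⟩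
  have g1 := htot.abs_integral_log_sub_log_le hσ fun h =>
    (hσd h).trans (le_add_of_nonneg_right (signal_nonneg hpower hρ N K ⟨k, hk⟩ h))
  have g2 := hdist.abs_integral_log_sub_log_le hσ hσd
  have b0 := noiseVar_le_integral_disturbance hm hΩ hpower hρ N K ⟨k, hk⟩
  have b1 := integral_disturbance_le hm hΩ hpower hρ N K (by omega) ⟨k, hk⟩
  have b2 := integral_signal_le hm hΩ hpower hρ N K (by omega) ⟨k, hk⟩
  have b3 := integral_signal_nonneg hpower hρ N K ⟨k, hk⟩
  have eI := integral_add (finiteMoments_disturbance hm hΩ N K ⟨k, hk⟩).integrable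
    (finiteMoments_signal hm hΩ N K ⟨k, hk⟩).integrable
  rw [ergodicPrivateRate_sub_approxPrivateRate hm hΩ hpower hρ hnoise]
  rw [eI] at g1 ⊢
  simp only at b0 b1 b2
  rw [← hm4_def] at b2
  set I1 := ∫ h, S.disturbance N K ⟨k, hk⟩ h ∂(S.channelLaw N K)
  set I2 := ∫ h, S.signal N K ⟨k, hk⟩ h ∂(S.channelLaw N K)
  -- The terms without a factor `N` are absorbed by `N ≥ 1`.
  have hsum : I1 + I2 ≤ R * N := by
    have e1 : (0 : ℝ) ≤ S.noiseVar k * (N - 1) := mul_nonneg hσ.le (by linarith)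
    have e2 : (0 : ℝ) ≤ S.power * S.errVar k * (N - 1) :=
      mul_nonneg (mul_nonneg hpower.le (S.errVar k).2) (by linarith)
    rw [hR_def]
    nlinarith
  have hI1 : 0 < I1 := hσ.trans_le b0
  have l1 : Real.log ((I1 + I2) / S.noiseVar k) ≤ Real.log (R / S.noiseVar k * N) := by
    refine Real.log_le_log (by positivity) ?_
    rw [div_mul_eq_mul_div]
    gcongr
  have l2 : Real.log (I1 / S.noiseVar k) ≤ Real.log (R / S.noiseVar k * N) :=
    le_trans (Real.log_le_log (by positivity) (by gcongr; linarith)) l1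
  have l0 : 0 ≤ Real.log (I1 / S.noiseVar k) := Real.log_nonneg ((one_le_div hσ).2 b0)
  set ℓ := Real.log (R / S.noiseVar k * N)
  have hlog2 : 0 < Real.log 2 := Real.log_pos one_lt_two
  rw [abs_div, abs_of_pos hlog2, div_le_iff₀ hlog2]
  refine (abs_sub _ _).trans ?_
  refine (add_le_add g1 g2).trans ?_
  have m1 : (2 + 4 * Real.log ((I1 + I2) / S.noiseVar k)) * (2 * (2 * (κ / N))) ≤
      (2 + 4 * ℓ) * (2 * (2 * (κ / N))) := by gcongr
  have m2 : (2 + 4 * Real.log (I1 / S.noiseVar k)) * (2 * (κ / N)) ≤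
      (2 + 4 * ℓ) * (2 * (κ / N)) := by gcongr
  have m3 : 0 ≤ (2 + 4 * ℓ) * (κ / N) := mul_nonneg (by linarith) hδ
  have m4 : (2 + 4 * ℓ) * (8 * κ / Real.log 2 / N) * Real.log 2 =
      8 * ((2 + 4 * ℓ) * (κ / N)) := by field_simp
  rw [m4]
  linarith

end LMSSystem

theorem theorem2 (S : LMSSystem) (m₀ M : ℝ) (hm₀ : 0 < m₀)
    (hm : ∀ i, m₀ ≤ S.m i)
    (hΩ : ∀ i, 0 < S.Ω i) (hΩM : ∀ i, S.Ω i ≤ M) (hbM : ∀ i, (S.b i : ℝ) ≤ M)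
    (hnoise : ∀ i, 0 < S.noiseVar i) (hpower : 0 < S.power)
    (hρ : S.ρ ∈ Set.Icc (0 : ℝ) 1) :
    -- the SINR of the private message
    (∀ (N K : ℕ) (k : Fin K) (h : Fin K → Fin N → ℂ),
      S.sinr N K k h =
        (S.alpha N K * (1 - S.ρ) * sqNorm (h k) ^ 2
            + S.alpha N K * (1 - S.ρ) * sqNorm (h k) * S.errVar k) /
          (S.noiseVar k + S.alpha N K * (1 - S.ρ) *
            ∑ i ∈ Finset.univ.erase k,
              (‖h k ⬝ᵥ star (h i)‖ ^ 2 + sqNorm (h k) * S.errVar i))) ∧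
    -- closed forms of the moments in the approximation
    (∀ k : ℕ, S.momentA k = 2 * S.b k + S.Ω k) ∧
    (∀ (N K : ℕ) (k : Fin K), S.momentD N K k =
      N * (4 * (S.b k : ℝ) ^ 2 + 4 * S.b k * S.Ω k + S.Ω k ^ 2 / S.m k)
        + (N : ℝ) ^ 2 * S.momentA k ^ 2) ∧
    (∀ (N K : ℕ) (k i : Fin K), i ≠ k → S.momentE N K k i =
      N * S.momentA k * S.momentA i
        + (N : ℝ) * ((N : ℝ) - 1) * S.meanC k ^ 2 * S.meanC i ^ 2) ∧
    -- the ergodic rate is well defined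
    (∀ (N K : ℕ) (k : Fin K), Integrable (S.privateRate N K k) (S.channelLaw N K)) ∧
    -- the gap vanishes as `N → ∞` and `K → ∞`
    (∀ k : ℕ, ∀ ε > 0, ∃ N₀ K₀ : ℕ, ∀ N ≥ N₀, ∀ K ≥ K₀, ∀ hk : k < K,
      |S.ergodicPrivateRate N K ⟨k, hk⟩ - S.approxPrivateRate N K ⟨k, hk⟩| < ε) := by
  have hm' (i : ℕ) : 0 < S.m i := hm₀.trans_le (hm i)
  refine ⟨LMSSystem.sinr_eq hpower hρ, LMSSystem.momentA_eq hm' hΩ, LMSSystem.momentD_eq hm' hΩ,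
    fun N K k i hik => LMSSystem.momentE_eq hm' hΩ N K hik,
    LMSSystem.integrable_privateRate hm' hΩ hpower hρ hnoise, fun k ε hε => ?_⟩
  obtain ⟨c, d, hc, h⟩ :=
    LMSSystem.exists_abs_ergodicPrivateRate_sub_le hm₀ hm hΩ hΩM hbM hnoise hpower hρ k
  obtain ⟨N₀, hN₀⟩ := Filter.eventually_atTop.1
    ((tendsto_order.1 (LMSSystem.tendsto_log_mul_div_atTop hc d)).2 ε hε)
  -- The threshold for `K` is `2` for every `ε`: a single interferer suffices, and the bound depends
  -- on `N` alone.
  exact ⟨max N₀ 2, 2, fun N hN K hK hk =>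
    (h N K (le_of_max_le_right hN) hK hk).trans_lt (hN₀ N (le_of_max_le_left hN))⟩
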